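/- Consider the uplink of a cell-free system with $M\ge 1$ single-antenna access points (APs), $K$ single-antenna users (UEs), unit-norm pilots $\varphi_1,\dots,\varphi_K\in\mathbb{C}^{\tau}$, hardware quality factors $\kappa_t,\kappa_r\in(0,1]$, powers $\rho_p,\rho_u>0$, noise variance $\sigma^2>0$, power control coefficients $\gamma_k\in[0,1]$ and large-scale fading coefficients $\beta_{mk}>0$. In each coherence interval the channels $g_{mk}\sim\mathcal{CN}(0,\beta_{mk})$ are independent and fixed. AP $m$ receives the pilot signal $$\mathbf y_{pm}=\sum_{k=1}^K\sqrt{\kappa_r}\,g_{mk}\left(\sqrt{\tau\rho_p\kappa_t}\,\varphi_k+\boldsymbol\eta_{kt}\right)+\boldsymbol\eta_{mr}+\mathbf w_{pm}\in\mathbb{C}^\tau ,$$ and then, in each of $T\ge 1$ data samples, $$y_{um}=\sum_{k=1}^K\sqrt{\kappa_r}\,g_{mk}\left(\sqrt{\rho_u\gamma_k\kappa_t}\,q_k+\eta_{kt}\right)+\eta_{mr}+w_{um}.$$ Conditionally on all channels, the following variables are independent of each other and over samples: in the pilot phase, the entries of $\boldsymbol\eta_{kt}$, $\boldsymbol\eta_{mr}$,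 $\mathbf w_{pm}$ are $\mathcal{CN}(0,\rho_p(1-\kappa_t))$, $\mathcal{CN}(0,\rho_p(1-\kappa_r)\sum_k|g_{mk}|^2)$, $\mathcal{CN}(0,\sigma^2)$; in the data phase, $\eta_{kt}\sim\mathcal{CN}(0,(1-\kappa_t)\rho_u\gamma_k)$, $\eta_{mr}\sim\mathcal{CN}(0,(1-\kappa_r)\rho_u\sum_k\gamma_k|g_{mk}|^2)$, $w_{um}\sim\mathcal{CN}(0,\sigma^2)$, and the symbols of the UEs are $q_k\sim\mathcal{CN}(0,1)$. Let $\breve y_{mk}=\varphi_k^H\mathbf y_{pm}$, let $\hat g_{mk}=\frac{\mathbb E\{\breve y_{mk}^*g_{mk}\}}{\mathbb E\{|\breve y_{mk}|^2\}}\breve y_{mk}$ be the LMMSE estimate, and let $r_{uk}=\sum_{m}\hat g_{mk}^*y_{um}$ be the maximum ratio combined signal at the CPU. The ergodic capacity of UE $k$ is the supremum, over all laws of its $T$ input symbols in a coherence interval with average power at most $1$ per symbol (independent of all else, the other UEs sending independent $\mathcal{CN}(0,1)$ symbols), of $\frac1T$ times the mutual information, in bits, between these symbols and the $T$ samples of $r_{uk}$.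 Set $$c_{mk}=\frac{\sqrt{\tau\rho_p\kappa_r\kappa_t}\,\beta_{mk}}{\rho_p\sum_{k'}\beta_{mk'}\left(\kappa_r\kappa_t\tau|\varphi_k^H\varphi_{k'}|^2+1-\kappa_r\kappa_t\right)+\sigma^2},\qquad \lambda_{mk}=\sqrt{\tau\rho_p\kappa_r\kappa_t}\,\beta_{mk}c_{mk}.$$ Then $\hat g_{mk}=c_{mk}\breve y_{mk}$, $\mathbb E\{|\hat g_{mk}|^2\}=\lambda_{mk}$, and the ergodic capacity of UE $k$ is at least $$R_{uk}=\log_2\left(1+\frac{\kappa_r\kappa_tA}{\kappa_rB+\kappa_rC-\kappa_r\kappa_tA+(1-\kappa_r)D+E}\right),$$ where $$A=\gamma_k\Big(\sum_m\lambda_{mk}\Big)^2,\qquad B=\sum_{k'}\gamma_{k'}\Big(\sum_m\lambda_{mk}\beta_{mk'}+\rho_p(1-\kappa_r)\sum_mc_{mk}^2\beta_{mk'}^2\Big),$$ $$C=\sum_{k'}\gamma_{k'}\Big(|\varphi_k^H\varphi_{k'}|^2+\frac{1-\kappa_t}{\kappa_t\tau}\Big)\Big(\sum_m\lambda_{mk}\frac{\beta_{mk'}}{\beta_{mk}}\Big)^2,\qquad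 E=\frac{\sigma^2}{\rho_u}\sum_m\lambda_{mk},$$ $$D=\sum_m\sum_{k'}\gamma_{k'}\Big(\lambda_{mk}\beta_{mk'}+c_{mk}^2(1-\kappa_r)\rho_p\beta_{mk'}^2+c_{mk}^2\kappa_r\rho_p\beta_{mk'}^2\big(\tau\kappa_t|\varphi_k^H\varphi_{k'}|^2+1-\kappa_t\big)\Big).$$ -/

import Mathlib

open MeasureTheory ProbabilityTheory InformationTheory
open scoped ENNReal NNReal ComplexConjugate

noncomputable section

namespace CellFree

/-- The circularly symmetric complex Gaussian law `CN(0, v)`: real and imaginary parts are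
independent real Gaussians of mean `0` and variance `v / 2`. -/
def complexGaussian (v : ℝ) : Measure ℂ :=
  ((gaussianReal 0 (v / 2).toNNReal).prod (gaussianReal 0 (v / 2).toNNReal)).map
    Complex.measurableEquivRealProd.symm

/-- The deterministic parameters of a cell-free massive MIMO uplink with `M` single-antenna APs,
`K` single-antenna UEs and pilots of length `τ`. -/
structure Params (M K τ : ℕ) where
  /-- large-scale fading: variance of the channel between AP `m` and UE `k` -/
  β : Fin M → Fin K → ℝ
  /-- power control coefficients -/
  γ : Fin K → ℝ
  /-- pilot sequences (before scaling by `√τ`) -/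
  φ : Fin K → EuclideanSpace ℂ (Fin τ)
  /-- hardware quality factor of the transmitters (UEs) -/
  κt : ℝ
  /-- hardware quality factor of the receivers (APs) -/
  κr : ℝ
  /-- transmit power of a pilot symbol -/
  ρp : ℝ
  /-- maximum transmit power of a UE in the data phase -/
  ρu : ℝ
  /-- variance of the additive receiver noise -/
  σ2 : ℝ

/-- Labels of all scalar random quantities of one coherence interval other than the channels:
`τ` pilot samples and `T` uplink data samples. -/
inductive Source (M K τ T : ℕ) : Type
  /-- transmitter distortion of UE `k` in a pilot sample -/
  | txPilot (k : Fin K) (i : Fin τ)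
  /-- receiver distortion of AP `m` in a pilot sample -/
  | rxPilot (m : Fin M) (i : Fin τ)
  /-- additive noise at AP `m` in a pilot sample -/
  | noisePilot (m : Fin M) (i : Fin τ)
  /-- information symbol of UE `k` in a data sample -/
  | symbol (k : Fin K) (t : Fin T)
  /-- transmitter distortion of UE `k` in a data sample -/
  | txData (k : Fin K) (t : Fin T)
  /-- receiver distortion of AP `m` in a data sample -/
  | rxData (m : Fin M) (t : Fin T)
  /-- additive noise at AP `m` in a data sample -/
  | noiseData (m : Fin M) (t : Fin T)

/-- The labels as a disjoint union of finite types. -/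
def sourceEquiv (M K τ T : ℕ) :
    ((Fin K × Fin τ) ⊕ (Fin M × Fin τ) ⊕ (Fin M × Fin τ) ⊕
      (Fin K × Fin T) ⊕ (Fin K × Fin T) ⊕ (Fin M × Fin T) ⊕ (Fin M × Fin T)) ≃
      Source M K τ T where
  toFun
    | .inl a => .txPilot a.1 a.2
    | .inr (.inl a) => .rxPilot a.1 a.2
    | .inr (.inr (.inl a)) => .noisePilot a.1 a.2
    | .inr (.inr (.inr (.inl a))) => .symbol a.1 a.2
    | .inr (.inr (.inr (.inr (.inl a)))) => .txData a.1 a.2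
    | .inr (.inr (.inr (.inr (.inr (.inl a))))) => .rxData a.1 a.2
    | .inr (.inr (.inr (.inr (.inr (.inr a))))) => .noiseData a.1 a.2
  invFun
    | .txPilot k i => .inl (k, i)
    | .rxPilot m i => .inr (.inl (m, i))
    | .noisePilot m i => .inr (.inr (.inl (m, i)))
    | .symbol k t => .inr (.inr (.inr (.inl (k, t))))
    | .txData k t => .inr (.inr (.inr (.inr (.inl (k, t)))))
    | .rxData m t => .inr (.inr (.inr (.inr (.inr (.inl (m, t))))))
    | .noiseData m t => .inr (.inr (.inr (.inr (.inr (.inr (m, t))))))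
  left_inv := by rintro (a | a | a | a | a | a | a) <;> rfl
  right_inv := by rintro (_ | _ | _ | _ | _ | _ | _) <;> rfl

instance (M K τ T : ℕ) : Fintype (Source M K τ T) :=
  Fintype.ofEquiv _ (sourceEquiv M K τ T)

variable {M K τ T : ℕ}

/-- Conditional variance of each random quantity, given the channel realization `h`. Only the
receiver distortions depend on `h`. -/
def Params.condVar (p : Params M K τ) (h : Fin M → Fin K → ℂ) : Source M K τ T → ℝ
  | .txPilot _ _ => p.ρp * (1 - p.κt)
  | .rxPilot m _ => p.ρp * (1 - p.κr) * ∑ k, ‖h m k‖ ^ 2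
  | .noisePilot _ _ => p.σ2
  | .symbol _ _ => 1
  | .txData k _ => (1 - p.κt) * p.ρu * p.γ k
  | .rxData m _ => (1 - p.κr) * p.ρu * ∑ k, p.γ k * ‖h m k‖ ^ 2
  | .noiseData _ _ => p.σ2

variable {Ω : Type*} [MeasurableSpace Ω]

/-- `g m k` are the channels and `Z s` the other random quantities of one coherence interval:
the channels are independent with `g m k ~ CN(0, β m k)` and, conditionally on all channels,
the `Z s` are independent with `Z s ~ CN(0, condVar s)`. -/
structure IsUplinkModel (p : Params M K τ) (μ : Measure Ω) [IsProbabilityMeasure μ]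
    (g : Fin M → Fin K → Ω → ℂ) (Z : Source M K τ T → Ω → ℂ) : Prop where
  measurable_channel : ∀ m k, Measurable (g m k)
  measurable_source : ∀ s, Measurable (Z s)
  channel_law : μ.map (fun ω m k => g m k ω) =
    Measure.pi (fun m => Measure.pi (fun k => complexGaussian (p.β m k)))
  conditional_law : ∀ᵐ h ∂(μ.map (fun ω m k => g m k ω)),
    condDistrib (fun ω s => Z s ω) (fun ω m k => g m k ω) μ h =
      Measure.pi (fun s => complexGaussian (p.condVar h s))

/-- Sample `i` of the pilot signal received by AP `m`. -/
def pilotSignal (p : Params M K τ) (g : Fin M → Fin K → Ω → ℂ) (Z : Source M K τ T → Ω → ℂ)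
    (m : Fin M) (i : Fin τ) (ω : Ω) : ℂ :=
  ∑ k, (√p.κr : ℂ) * g m k ω * ((√(τ * p.ρp * p.κt) : ℂ) * p.φ k i + Z (.txPilot k i) ω)
    + Z (.rxPilot m i) ω + Z (.noisePilot m i) ω

/-- The despread pilot signal: inner product of the pilot of UE `k` and the pilot signal received
by AP `m`. -/
def despread (p : Params M K τ) (g : Fin M → Fin K → Ω → ℂ) (Z : Source M K τ T → Ω → ℂ)
    (m : Fin M) (k : Fin K) (ω : Ω) : ℂ :=
  ∑ i, conj (p.φ k i) * pilotSignal p g Z m i ω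

/-- Coefficient of the linear MMSE estimate of `X` from the scalar observation `Y`. -/
def lmmseCoeff (μ : Measure Ω) (Y X : Ω → ℂ) : ℂ :=
  (∫ ω, conj (Y ω) * X ω ∂μ) / ((∫ ω, ‖Y ω‖ ^ 2 ∂μ : ℝ) : ℂ)

/-- LMMSE estimate of the channel between AP `m` and UE `k`, from the despread pilot signal. -/
def channelEstimate (p : Params M K τ) (μ : Measure Ω) (g : Fin M → Fin K → Ω → ℂ)
    (Z : Source M K τ T → Ω → ℂ) (m : Fin M) (k : Fin K) (ω : Ω) : ℂ :=
  lmmseCoeff μ (despread p g Z m k) (g m k) * despread p g Z m k ω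

/-- Data sample `t` received by AP `m` when UE `k` sends the symbols `x` and every other UE sends
its own Gaussian symbols. -/
def dataSignal (p : Params M K τ) (g : Fin M → Fin K → Ω → ℂ) (Z : Source M K τ T → Ω → ℂ)
    (k : Fin K) (x : Fin T → ℂ) (m : Fin M) (t : Fin T) (ω : Ω) : ℂ :=
  ∑ j, (√p.κr : ℂ) * g m j ω *
      ((√(p.ρu * p.γ j * p.κt) : ℂ) * (if j = k then x t else Z (.symbol j t) ω)
        + Z (.txData j t) ω)
    + Z (.rxData m t) ω + Z (.noiseData m t) ω

/-- The maximum ratio combined signal at the CPU, over the data samples of a coherence interval. -/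
def combinedSignal (p : Params M K τ) (μ : Measure Ω) (g : Fin M → Fin K → Ω → ℂ)
    (Z : Source M K τ T → Ω → ℂ) (k : Fin K) (x : Fin T → ℂ) (ω : Ω) : Fin T → ℂ :=
  fun t => ∑ m, conj (channelEstimate p μ g Z m k ω) * dataSignal p g Z k x m t ω

/-- Mutual information (in nats) of a joint law. -/
def mutualInfo {X Y : Type*} [MeasurableSpace X] [MeasurableSpace Y] (ν : Measure (X × Y)) :
    ℝ≥0∞ :=
  klDiv ν (ν.fst.prod ν.snd)

/-- Ergodic capacity, in bits per sample, of the channel that maps the `T` input symbols `x` of a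
coherence interval to the output `f x ω`, with `ω` of law `μ` independent of the input and
unknown at both ends (coherence intervals being independent copies of each other): the supremum
of the mutual information per sample between input and output, over all input laws of average
power at most `1` per sample. -/
def ergodicCapacity (μ : Measure Ω) (f : (Fin T → ℂ) → Ω → (Fin T → ℂ)) : ℝ≥0∞ :=
  ⨆ (P : Measure (Fin T → ℂ)) (_ : IsProbabilityMeasure P)
    (_ : ∫⁻ x, ∑ t, ‖x t‖ₑ ^ 2 ∂P ≤ (T : ℝ≥0∞)),
    mutualInfo ((P.prod μ).map (fun z => (z.1, f z.1 z.2))) / ENNReal.ofReal (T * Real.log 2)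

/-- Capacity of the uplink of UE `k`: from its information symbols to the combined signal at
the CPU. -/
def uplinkCapacity (p : Params M K τ) (μ : Measure Ω) (g : Fin M → Fin K → Ω → ℂ)
    (Z : Source M K τ T → Ω → ℂ) (k : Fin K) : ℝ≥0∞ :=
  ergodicCapacity μ (combinedSignal p μ g Z k)

namespace Params

variable (p : Params M K τ)

/-- `|φ_kᴴ φ_j|²`. -/
def pilotCorr (k j : Fin K) : ℝ := ‖inner ℂ (p.φ k) (p.φ j)‖ ^ 2

/-- The coefficient `c_mk`. -/
def c (m : Fin M) (k : Fin K) : ℝ :=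
  √(τ * p.ρp * (p.κr * p.κt)) * p.β m k /
    (p.ρp * ∑ j, p.β m j * (p.κr * p.κt * τ * p.pilotCorr k j + (1 - p.κr * p.κt)) + p.σ2)

/-- The estimate power `λ_mk`. -/
def lam (m : Fin M) (k : Fin K) : ℝ := √(τ * p.ρp * (p.κr * p.κt)) * p.β m k * p.c m k

/-- Desired signal. -/
def termA (k : Fin K) : ℝ := p.γ k * (∑ m, p.lam m k) ^ 2

/-- Non-coherent power. -/
def termB (k : Fin K) : ℝ :=
  ∑ j, p.γ j * (∑ m, p.lam m k * p.β m j + p.ρp * (1 - p.κr) * ∑ m, p.c m k ^ 2 * p.β m j ^ 2)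

/-- Coherent power. -/
def termC (k : Fin K) : ℝ :=
  ∑ j, p.γ j * (p.pilotCorr k j + (1 - p.κt) / (p.κt * τ)) *
    (∑ m, p.lam m k * (p.β m j / p.β m k)) ^ 2

/-- Receiver distortion. -/
def termD (k : Fin K) : ℝ :=
  ∑ m, ∑ j, p.γ j * (p.lam m k * p.β m j
    + p.c m k ^ 2 * (1 - p.κr) * p.ρp * p.β m j ^ 2
    + p.c m k ^ 2 * p.κr * p.ρp * p.β m j ^ 2 * (τ * p.κt * p.pilotCorr k j + (1 - p.κt)))

/-- Additive noise. -/
def termE (k : Fin K) : ℝ := p.σ2 / p.ρu * ∑ m, p.lam m k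

/-- The closed-form spectral efficiency of UE `k`, in bits per sample. -/
def rate (k : Fin K) : ℝ :=
  Real.logb 2 (1 + p.κr * p.κt * p.termA k /
    (p.κr * p.termB k + p.κr * p.termC k - p.κr * p.κt * p.termA k
      + (1 - p.κr) * p.termD k + p.termE k))

end Params

end CellFree

end

/-! The bound is "use and then forget": the receiver treats the mean of the effective gain as the
true channel and everything else as noise. Take i.i.d. `CN(0,1)` inputs. Mutual information is the
divergence of the joint law of (x, r) from the product of its marginals, so the Donsker–Varadhan
inequality bounds it below by the mean of any F with E exp F ≤ 1 under the product law. Choose F to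
be the log-ratio of the Gaussian backward channel x_t ~ CN(a r_t, v) to the input law
(`backwardLogRatio`). For each fixed r its exponential integrates to 1, and when v is the mean
squared error of the estimate a r_t, its mean is -T log v (`ofReal_mul_log_le_mutualInfo`). No
Gaussianity of the noise, no law of the output and no independence across samples is needed.

With the optimal a, v = 1 - G²/S, where G x_t is the mean of the combined signal given x and S is
its power at unit symbol power. It remains to compute G and S. Given the channels, pilot and data
signals are affine in independent Gaussians, over disjoint sets of sources, so the conditional mean
of a product splits into two conditional covariances (`conditional_product`). These are Hermitian
forms in the channels, because the receiver distortion has a variance quadratic in the channels. The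
mean of their product is a fourth-order Gaussian moment, given by Wick's formula
(`integral_pi_wick`, `integral_channel_forms`). Collecting terms (`combinedPower_one`,
`combinedGain_sq`) gives S = ρu (κr B + κr C + (1-κr) D + E) and G² = ρu κr κt A, so -log v is the
stated rate in nats. -/

noncomputable section

namespace CellFree

/-! ### Random variables with all moments -/

section Moments

variable {α : Type*} [MeasurableSpace α] {μ : Measure α} {f f' : α → ℂ}

/-- All absolute moments of the complex random variable `f` are finite. -/
def HasMoments (f : α → ℂ) (μ : Measure α) : Prop := ∀ n : ℕ, MemLp f n μ

theorem HasMoments.integrable (hf : HasMoments f μ) : Integrable f μ :=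
  memLp_one_iff_integrable.1 (by simpa using hf 1)

theorem HasMoments.add (hf : HasMoments f μ) (hf' : HasMoments f' μ) :
    HasMoments (fun x => f x + f' x) μ := fun n => (hf n).add (hf' n)

/-- Hölder with exponents 2n, 2n and n makes these variables an algebra. Integrability of every
polynomial in channels and sources then needs no bookkeeping of exponents. -/
theorem HasMoments.mul (hf : HasMoments f μ) (hf' : HasMoments f' μ) :
    HasMoments (fun x => f x * f' x) μ := by
  intro n
  have : ENNReal.HolderTriple ((2 * n : ℕ) : ℝ≥0∞) ((2 * n : ℕ) : ℝ≥0∞) (n : ℝ≥0∞) := by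
    constructor
    push_cast
    rw [ENNReal.mul_inv (by simp) (by simp), ← add_mul, ENNReal.inv_two_add_inv_two, one_mul]
  exact MemLp.mul' (hf' (2 * n)) (hf (2 * n))

theorem HasMoments.conj (hf : HasMoments f μ) : HasMoments (fun x => conj (f x)) μ :=
  fun n => (hf n).star

theorem hasMoments_const [IsFiniteMeasure μ] (c : ℂ) : HasMoments (fun _ => c) μ :=
  fun _ => memLp_const c

theorem HasMoments.sum {ι : Type*} (s : Finset ι) {F : ι → α → ℂ}
    (hF : ∀ i ∈ s, HasMoments (F i) μ) : HasMoments (fun x => ∑ i ∈ s, F i x) μ :=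
  fun n => memLp_finsetSum s fun i hi => hF i hi n

theorem HasMoments.comp_map {β : Type*} [MeasurableSpace β] {φ : β → α} {ν : Measure β}
    (hφ : Measurable φ) (hf : HasMoments f (ν.map φ)) : HasMoments (fun x => f (φ x)) ν :=
  fun n => (hf n).comp_of_map hφ.aemeasurable

theorem HasMoments.pi_eval {ι : Type*} [Fintype ι] {ν : ι → Measure ℂ}
    [∀ i, IsProbabilityMeasure (ν i)] {F : ℂ → ℂ} {i : ι} (hF : HasMoments F (ν i)) :
    HasMoments (fun z : ι → ℂ => F (z i)) (Measure.pi ν) := by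
  refine HasMoments.comp_map (measurable_pi_apply i) ?_
  rwa [(measurePreserving_eval ν i).map_eq]

end Moments

/-! ### Moments of the circular complex Gaussian -/

section ComplexGaussian

instance (v : ℝ) : IsProbabilityMeasure (complexGaussian v) := by
  unfold complexGaussian
  exact Measure.isProbabilityMeasure_map (by fun_prop)

/-- Separates a variance, later random, from a standard Gaussian. For v < 0 both sides are the Dirac
mass at 0, by the truncations in `Real.toNNReal` and `√`. -/
theorem complexGaussian_eq_map_one (v : ℝ) :
    complexGaussian v = (complexGaussian 1).map (fun z => (√v : ℂ) * z) := by
  have hg : gaussianReal 0 (v / 2).toNNReal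
      = (gaussianReal 0 ((1 : ℝ) / 2).toNNReal).map (√v * ·) := by
    rw [gaussianReal_map_const_mul, mul_zero]
    congr 1
    ext
    rcases le_total 0 v with h | h
    · simp only [NNReal.coe_mul, NNReal.coe_mk, Real.sq_sqrt h]
      rw [Real.coe_toNNReal _ (by positivity), Real.coe_toNNReal _ (by positivity)]
      ring
    · simp [Real.sqrt_eq_zero_of_nonpos h, Real.toNNReal_of_nonpos (by linarith : v / 2 ≤ 0)]
  unfold complexGaussian
  rw [hg, Measure.map_prod_map _ _ (by fun_prop) (by fun_prop),
    Measure.map_map (by fun_prop) (by fun_prop), Measure.map_map (by fun_prop) (by fun_prop)]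
  congr 1
  ext x
  apply Complex.ext <;> simp [Complex.measurableEquivRealProd]

theorem hasMoments_complexGaussian (v : ℝ) : HasMoments (fun z => z) (complexGaussian v) := by
  unfold complexGaussian
  intro n
  rw [memLp_map_measure_iff (by fun_prop) (by fun_prop)]
  have h := memLp_id_gaussianReal' (μ := 0) (v := (v / 2).toNNReal) n (by simp)
  have h1 := (h.comp_fst (gaussianReal 0 (v / 2).toNNReal)).ofReal (K := ℂ)
  have h2 := (h.comp_snd (gaussianReal 0 (v / 2).toNNReal)).ofReal (K := ℂ)
  refine (h1.add (h2.const_mul Complex.I)).ae_eq (Filter.Eventually.of_forall fun x => ?_)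
  apply Complex.ext <;> simp [Complex.measurableEquivRealProd]

/-- Multiplication by i sends (re, im) to (-im, re), which preserves a symmetric product law. This
quarter turn is all the circular symmetry that the fourth-order moments require. -/
theorem complexGaussian_map_I_mul (v : ℝ) :
    (complexGaussian v).map (fun z => Complex.I * z) = complexGaussian v := by
  have hn : (gaussianReal 0 (v / 2).toNNReal).map (fun x => -x)
      = gaussianReal 0 (v / 2).toNNReal := by simp [gaussianReal_map_neg]
  have hs : ((gaussianReal 0 (v / 2).toNNReal).prod (gaussianReal 0 (v / 2).toNNReal)).map
      (fun x => (-x.2, x.1)) = (gaussianReal 0 (v / 2).toNNReal).prod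
        (gaussianReal 0 (v / 2).toNNReal) := by
    have : (fun x : ℝ × ℝ => (-x.2, x.1)) = Prod.map (fun x => -x) id ∘ Prod.swap := rfl
    rw [this, ← Measure.map_map (by fun_prop) (by fun_prop), Measure.prod_swap,
      ← Measure.map_prod_map _ _ (by fun_prop) (by fun_prop), hn, Measure.map_id]
  unfold complexGaussian
  conv_rhs => rw [← hs]
  rw [Measure.map_map (by fun_prop) (by fun_prop), Measure.map_map (by fun_prop) (by fun_prop)]
  congr 1
  ext x
  apply Complex.ext <;> simp [Complex.measurableEquivRealProd]

theorem integral_complexGaussian_I_mul (v : ℝ) (F : ℂ → ℂ) (hF : Measurable F) :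
    ∫ z, F (Complex.I * z) ∂complexGaussian v = ∫ z, F z ∂complexGaussian v := by
  conv_rhs => rw [← complexGaussian_map_I_mul]
  rw [integral_map (by fun_prop) hF.aestronglyMeasurable]

/-- The mixed moments of a circularly symmetric Gaussian vanish unless the degrees agree
modulo 4. -/
theorem integral_complexGaussian_eq_zero (v : ℝ) (a b : ℕ)
    (h : (-Complex.I) ^ a * Complex.I ^ b ≠ 1) :
    ∫ z, conj z ^ a * z ^ b ∂complexGaussian v = 0 := by
  -- The substitution z ↦ i z multiplies the moment by (-i)^a i^b without changing its value.
  have h1 := integral_complexGaussian_I_mul v (fun z => conj z ^ a * z ^ b) (by fun_prop)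
  have h2 : ∀ z : ℂ, conj (Complex.I * z) ^ a * (Complex.I * z) ^ b
      = ((-Complex.I) ^ a * Complex.I ^ b) * (conj z ^ a * z ^ b) := by
    intro z
    simp only [map_mul, Complex.conj_I, mul_pow]
    ring
  simp only [h2, integral_const_mul] at h1
  have h3 : ((-Complex.I) ^ a * Complex.I ^ b - 1) *
      ∫ z, conj z ^ a * z ^ b ∂complexGaussian v = 0 := by
    rw [sub_mul, one_mul, h1, sub_self]
  exact (mul_eq_zero.1 h3).resolve_left (sub_ne_zero.2 h)

theorem integral_sq_gaussianReal (v : ℝ≥0) : ∫ x, x ^ 2 ∂gaussianReal 0 v = v := by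
  have := variance_fun_id_gaussianReal (μ := 0) (v := v)
  rwa [variance_of_integral_eq_zero (by fun_prop) (by simp)] at this

theorem integral_pow_four_gaussianReal (v : ℝ≥0) :
    ∫ x, x ^ 4 ∂gaussianReal 0 v = 3 * (v : ℝ) ^ 2 := by
  have h := iteratedDeriv_mgf_zero (X := id) (μ := gaussianReal 0 v) (by simp) 4
  rw [mgf_id_gaussianReal] at h
  -- Differentiating q(t) exp(v t²/2) replaces q by q' + v t q. From q = 1 the polynomials are v t,
  -- v + v² t², 3 v² t + v³ t³; the next one has value 3 v² at 0.
  have hd : ∀ (q q' : ℝ → ℝ), (∀ t, HasDerivAt q (q' t) t) →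
      deriv (fun t => q t * Real.exp (v * t ^ 2 / 2))
        = fun t => (q' t + v * t * q t) * Real.exp (v * t ^ 2 / 2) := by
    intro q q' hq
    funext t
    have h1 : HasDerivAt (fun t : ℝ => (v : ℝ) * t ^ 2 / 2) (v * t) t := by
      have := ((hasDerivAt_pow 2 t).const_mul (v : ℝ)).div_const 2
      refine this.congr_deriv ?_
      push_cast
      ring
    refine ((hq t).mul h1.exp).deriv.trans ?_
    ring
  have h0 : (fun t : ℝ => Real.exp (0 * t + v * t ^ 2 / 2))
      = fun t => 1 * Real.exp (v * t ^ 2 / 2) := by simp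
  rw [h0] at h
  simp only [iteratedDeriv_succ, iteratedDeriv_zero] at h
  have e1 := hd (fun _ => 1) (fun _ => 0) (fun t => hasDerivAt_const t 1)
  have e2 := hd (fun t => v * t) (fun _ => v) (fun t => by
    simpa using (hasDerivAt_id t).const_mul (v : ℝ))
  have e3 := hd (fun t => v + v ^ 2 * t ^ 2) (fun t => 2 * v ^ 2 * t) (fun t => by
    have := ((hasDerivAt_pow 2 t).const_mul ((v : ℝ) ^ 2)).const_add (v : ℝ)
    refine this.congr_deriv ?_
    push_cast
    ring)
  have e4 := hd (fun t => 3 * v ^ 2 * t + v ^ 3 * t ^ 3)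
    (fun t => 3 * v ^ 2 + 3 * v ^ 3 * t ^ 2) (fun t => by
    have := ((hasDerivAt_id t).const_mul (3 * (v : ℝ) ^ 2)).add
      ((hasDerivAt_pow 3 t).const_mul ((v : ℝ) ^ 3))
    refine this.congr_deriv ?_
    push_cast
    ring)
  have r1 : ∀ t : ℝ, 0 + v * t * 1 = v * t := fun t => by ring
  have r2 : ∀ t : ℝ, v + v * t * (v * t) = v + v ^ 2 * t ^ 2 := fun t => by ring
  have r3 : ∀ t : ℝ, 2 * v ^ 2 * t + v * t * (v + v ^ 2 * t ^ 2)
      = 3 * v ^ 2 * t + v ^ 3 * t ^ 3 := fun t => by ring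
  simp only [r1] at e1
  simp only [r2] at e2
  simp only [r3] at e3
  rw [e1, e2, e3, e4] at h
  simpa using h.symm

theorem integral_norm_sq_complexGaussian {v : ℝ} (hv : 0 ≤ v) :
    ∫ z, conj z * z ∂complexGaussian v = (v : ℂ) := by
  have hL : Integrable (fun x => x ^ 2) (gaussianReal 0 (v / 2).toNNReal) :=
    (memLp_id_gaussianReal (μ := 0) (v := (v / 2).toNNReal) 2).integrable_sq
  have h : ∀ z : ℂ, conj z * z = ((z.re ^ 2 + z.im ^ 2 : ℝ) : ℂ) := by
    intro z
    rw [← Complex.normSq_eq_conj_mul_self, Complex.normSq_apply]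
    push_cast
    ring
  simp only [h, integral_complex_ofReal]
  unfold complexGaussian
  rw [integral_map_equiv]
  simp only [Complex.measurableEquivRealProd_symm_apply]
  rw [integral_add (hL.comp_fst _) (hL.comp_snd _), integral_fun_fst (fun x : ℝ => x ^ 2),
    integral_fun_snd (fun x : ℝ => x ^ 2), integral_sq_gaussianReal]
  rw [Real.coe_toNNReal _ (by positivity)]
  simp

/-- With real and imaginary variances v/2, the fourth powers give 2 · 3 v²/4 and the cross term
gives 2 · v²/4. -/
theorem integral_norm_pow_four_complexGaussian {v : ℝ} (hv : 0 ≤ v) :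
    ∫ z, conj z ^ 2 * z ^ 2 ∂complexGaussian v = 2 * (v : ℂ) ^ 2 := by
  have hL : Integrable (fun x => x ^ 2) (gaussianReal 0 (v / 2).toNNReal) :=
    (memLp_id_gaussianReal (μ := 0) (v := (v / 2).toNNReal) 2).integrable_sq
  have hL4 : Integrable (fun x => x ^ 4) (gaussianReal 0 (v / 2).toNNReal) := by
    have := (memLp_id_gaussianReal (μ := 0) (v := (v / 2).toNNReal) 4).integrable_norm_pow
      (by norm_num)
    refine this.congr (Filter.Eventually.of_forall fun x => ?_)
    simp [Real.norm_eq_abs, (by decide : Even 4).pow_abs]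
  have h : ∀ z : ℂ, conj z ^ 2 * z ^ 2
      = ((z.re ^ 4 + 2 * (z.re ^ 2 * z.im ^ 2) + z.im ^ 4 : ℝ) : ℂ) := by
    intro z
    have : conj z * z = ((z.re ^ 2 + z.im ^ 2 : ℝ) : ℂ) := by
      rw [← Complex.normSq_eq_conj_mul_self, Complex.normSq_apply]
      push_cast
      ring
    rw [← mul_pow, this]
    push_cast
    ring
  simp only [h, integral_complex_ofReal]
  unfold complexGaussian
  rw [integral_map_equiv]
  simp only [Complex.measurableEquivRealProd_symm_apply]
  rw [integral_add (by exact (hL4.comp_fst _).add ((hL.mul_prod hL).const_mul 2)) (hL4.comp_snd _),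
    integral_add (hL4.comp_fst _) ((hL.mul_prod hL).const_mul 2),
    integral_fun_fst (fun x : ℝ => x ^ 4), integral_const_mul,
    integral_prod_mul (fun x : ℝ => x ^ 2) (fun x : ℝ => x ^ 2),
    integral_fun_snd (fun x : ℝ => x ^ 4), integral_sq_gaussianReal,
    integral_pow_four_gaussianReal]
  rw [Real.coe_toNNReal _ (by positivity)]
  simp
  ring

end ComplexGaussian

/-! ### Independent complex Gaussian families: factorization, Wick's formula, affine forms -/

section PiGaussian

variable {ι : Type*} [Fintype ι] {v : ι → ℝ}

theorem integral_mul_of_dependsOn {ν : ι → Measure ℂ} [∀ i, IsProbabilityMeasure (ν i)]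
    (S : Finset ι) {F G : (ι → ℂ) → ℂ} (hF : Measurable F) (hG : Measurable G)
    (hFS : DependsOn F (S : Set ι)) (hGS : DependsOn G ((S : Set ι)ᶜ)) :
    ∫ z, F z * G z ∂Measure.pi ν = (∫ z, F z ∂Measure.pi ν) * ∫ z, G z ∂Measure.pi ν := by
  classical
  -- Padding by 0 outside A rewrites a function depending only on the coordinates in A as a function
  -- of the restriction to A, to which independence applies.
  let ext : ∀ A : Finset ι, (A → ℂ) → (ι → ℂ) := fun A w i => if h : i ∈ A then w ⟨i, h⟩ else 0
  have hext : ∀ A, Measurable (ext A) := by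
    intro A
    refine measurable_pi_lambda _ fun i => ?_
    by_cases h : i ∈ A <;> simp only [ext, h, dite_true, dite_false] <;> fun_prop
  have hI := (iIndepFun_pi (μ := ν) (X := fun _ z => z) (fun _ => aemeasurable_id)).indepFun_finset
    S Sᶜ disjoint_compl_right (fun i => measurable_pi_apply i)
  have hI' := hI.comp (hF.comp (hext S)) (hG.comp (hext Sᶜ))
  have e1 : (F ∘ ext S) ∘ (fun (z : ι → ℂ) (i : S) => z i) = F := by
    funext z
    refine hFS fun i hi => ?_
    have : i ∈ S := hi
    simp [ext, this]
  have e2 : (G ∘ ext Sᶜ) ∘ (fun (z : ι → ℂ) (i : (Sᶜ : Finset ι)) => z i) = G := by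
    funext z
    refine hGS fun i hi => ?_
    have : i ∉ S := hi
    simp [ext, this]
  rw [e1, e2] at hI'
  exact hI'.integral_fun_mul_eq_mul_integral hF.aestronglyMeasurable hG.aestronglyMeasurable

/-- The mixed moments of independent complex Gaussians factor. -/
theorem integral_pi_monomial (a b : ι → ℕ) :
    ∫ z, ∏ s, (conj (z s) ^ a s * z s ^ b s) ∂Measure.pi (fun i => complexGaussian (v i)) =
      ∏ s, ∫ w, conj w ^ a s * w ^ b s ∂complexGaussian (v s) :=
  integral_fintype_prod_eq_prod (fun s w => conj w ^ a s * w ^ b s)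

theorem integral_pi_eval (F : ℂ → ℂ) (hF : Measurable F) (i : ι) :
    ∫ z, F (z i) ∂Measure.pi (fun i => complexGaussian (v i)) = ∫ w, F w ∂complexGaussian (v i) :=
  integral_comp_eval hF.aestronglyMeasurable

theorem integral_pi_coord (i : ι) :
    ∫ z, z i ∂Measure.pi (fun i => complexGaussian (v i)) = 0 := by
  rw [integral_pi_eval (fun w => w) measurable_id]
  simpa using integral_complexGaussian_eq_zero (v i) 0 1 (by simp [Complex.ext_iff])

theorem integral_pi_covariance [DecidableEq ι] (hv : ∀ i, 0 ≤ v i) (i j : ι) :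
    ∫ z, conj (z i) * z j ∂Measure.pi (fun i => complexGaussian (v i)) =
      if i = j then (v i : ℂ) else 0 := by
  split_ifs with h
  · subst h
    rw [integral_pi_eval (fun w => conj w * w) (by fun_prop),
      integral_norm_sq_complexGaussian (hv i)]
  · rw [integral_mul_of_dependsOn {i} (by fun_prop) (by fun_prop), integral_pi_coord, mul_zero]
    · intro z z' hz
      simp [hz i (by simp)]
    · intro z z' hz
      exact hz j (by simp [Ne.symm h])

/-- Wick's formula of order four for independent complex Gaussians. -/
theorem integral_pi_wick [DecidableEq ι] (hv : ∀ i, 0 ≤ v i) (i j k l : ι) :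
    ∫ z, conj (z i) * z j * (z k * conj (z l)) ∂Measure.pi (fun i => complexGaussian (v i)) =
      (if i = j ∧ k = l then (v i : ℂ) * v k else 0) +
        (if i = k ∧ j = l then (v i : ℂ) * v j else 0) := by
  -- The exponents a and b count, for each coordinate, its conjugated and plain occurrences. One
  -- unbalanced coordinate already kills the whole moment (`hzero`).
  let a : ι → ℕ := fun s => (if s = i then 1 else 0) + (if s = l then 1 else 0)
  let b : ι → ℕ := fun s => (if s = j then 1 else 0) + (if s = k then 1 else 0)
  have hmono : ∀ z : ι → ℂ, conj (z i) * z j * (z k * conj (z l))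
      = ∏ s, (conj (z s) ^ a s * z s ^ b s) := by
    intro z
    simp only [a, b, pow_add, Finset.prod_mul_distrib, pow_ite, pow_one, pow_zero,
      Finset.prod_ite_eq', Finset.mem_univ, if_true]
    ring
  have hzero : ∀ s, (-Complex.I) ^ a s * Complex.I ^ b s ≠ 1 →
      ∫ z, conj (z i) * z j * (z k * conj (z l)) ∂Measure.pi (fun i => complexGaussian (v i))
        = 0 := by
    intro s hs
    simp only [hmono]
    rw [integral_pi_monomial]
    exact Finset.prod_eq_zero (Finset.mem_univ s) (integral_complexGaussian_eq_zero _ _ _ hs)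
  have hpair : ∀ m n, m ≠ n → ∫ z, (conj (z m) * z m) * (conj (z n) * z n)
      ∂Measure.pi (fun i => complexGaussian (v i)) = (v m : ℂ) * v n := by
    intro m n hmn
    rw [integral_mul_of_dependsOn (ν := fun i => complexGaussian (v i)) {m}
      (F := fun z => conj (z m) * z m) (G := fun z => conj (z n) * z n)
      (by fun_prop) (by fun_prop), integral_pi_covariance hv, integral_pi_covariance hv]
    · simp
    · intro z z' hz
      simp [hz m (by simp)]
    · intro z z' hz
      simp [hz n (by simp [Ne.symm hmn])]
  -- Three kinds of case remain: all four indices equal, where both pairings hold and E|z|⁴ = 2v²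
  -- matches; two distinct balanced coordinates, which factor by `hpair`; or an unbalanced
  -- coordinate.
  by_cases hil : i = l
  · subst hil
    by_cases hj : i = j
    · subst hj
      by_cases hk : i = k
      · subst hk
        have h := integral_pi_eval (v := v) (fun w => conj w ^ 2 * w ^ 2) (by fun_prop) i
        rw [integral_norm_pow_four_complexGaussian (hv i)] at h
        simp only [and_self, if_true]
        calc _ = ∫ z, conj (z i) ^ 2 * z i ^ 2 ∂Measure.pi (fun i => complexGaussian (v i)) := by
              congr 1; ext z; ring
          _ = _ := by rw [h]; ring
      · rw [hzero i (by simp [a, b, hk, Complex.ext_iff])]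
        simp [hk, Ne.symm hk]
    · rw [hzero i]
      · simp [hj, Ne.symm hj]
      · by_cases hk : i = k
        · subst hk
          simp [a, b, hj, Complex.ext_iff, pow_two]
        · norm_num [a, b, hj, hk, Complex.ext_iff, pow_two]
  · by_cases hj : i = j
    · subst hj
      by_cases hk : i = k
      · subst hk
        rw [hzero i (by simp [a, b, hil, Complex.ext_iff, pow_two])]
        simp [hil]
      · by_cases hkl : k = l
        · subst hkl
          simp only [hk, and_self, if_true, if_false, add_zero]
          rw [← hpair i k hk]
          congr 1; ext z; ring
        · rw [hzero l (by simp [a, b, Ne.symm hil, Ne.symm hkl, Complex.ext_iff])]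
          simp [hk, hkl]
    · by_cases hk : i = k
      · subst hk
        by_cases hjl : j = l
        · subst hjl
          simp only [hj, and_self, if_true, if_false, zero_add]
          rw [← hpair i j hj]
          congr 1; ext z; ring
        · rw [hzero l (by simp [a, b, Ne.symm hil, Ne.symm hjl, Complex.ext_iff])]
          simp [hj, hjl]
      · rw [hzero i (by simp [a, b, hil, hj, hk, Complex.ext_iff])]
        simp [hj, hk]

/-- The affine form `a + ∑ s, b s * z s`. -/
def affineForm (a : ℂ) (b : ι → ℂ) (z : ι → ℂ) : ℂ := a + ∑ s, b s * z s

@[fun_prop]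
theorem measurable_affineForm (a : ℂ) (b : ι → ℂ) : Measurable (affineForm a b) := by
  unfold affineForm
  fun_prop

theorem hasMoments_coord (i : ι) :
    HasMoments (fun z : ι → ℂ => z i) (Measure.pi (fun i => complexGaussian (v i))) :=
  (hasMoments_complexGaussian (v i)).pi_eval (ν := fun i => complexGaussian (v i))

theorem hasMoments_affineForm (a : ℂ) (b : ι → ℂ) :
    HasMoments (affineForm a b) (Measure.pi (fun i => complexGaussian (v i))) :=
  (hasMoments_const a).add (HasMoments.sum _ fun i _ => (hasMoments_const (b i)).mul
    (hasMoments_coord i))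

theorem integral_affineForm (a : ℂ) (b : ι → ℂ) :
    ∫ z, affineForm a b z ∂Measure.pi (fun i => complexGaussian (v i)) = a := by
  have hb : ∀ i ∈ Finset.univ, Integrable (fun z : ι → ℂ => b i * z i)
      (Measure.pi (fun i => complexGaussian (v i))) :=
    fun i _ => ((hasMoments_coord i).integrable).const_mul (b i)
  unfold affineForm
  rw [integral_add (integrable_const a) (integrable_finsetSum _ hb), integral_finsetSum _ hb]
  simp [integral_const_mul, integral_pi_coord]

theorem integral_affineForm_conj_mul (hv : ∀ i, 0 ≤ v i) (a a' : ℂ) (b b' : ι → ℂ) :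
    ∫ z, conj (affineForm a b z) * affineForm a' b' z
        ∂Measure.pi (fun i => complexGaussian (v i)) =
      conj a * a' + ∑ s, conj (b s) * b' s * v s := by
  classical
  have hc : ∀ s t, Integrable (fun z : ι → ℂ => conj (b s) * b' t * (conj (z s) * z t))
      (Measure.pi (fun i => complexGaussian (v i))) := fun s t =>
    (((hasMoments_coord s).conj.mul (hasMoments_coord t)).integrable).const_mul _
  have hb : ∀ (c : ι → ℂ) (a : ℂ), ∫ z, affineForm 0 c z * a
      ∂Measure.pi (fun i => complexGaussian (v i)) = 0 := by
    intro c a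
    rw [integral_mul_const, integral_affineForm, zero_mul]
  have hb' : ∀ (c : ι → ℂ) (a : ℂ), ∫ z, conj (affineForm 0 c z) * a
      ∂Measure.pi (fun i => complexGaussian (v i)) = 0 := by
    intro c a
    rw [integral_mul_const, integral_conj, integral_affineForm, map_zero, zero_mul]
  have hm : ∀ c : ι → ℂ, HasMoments (affineForm 0 c)
      (Measure.pi (fun i => complexGaussian (v i))) := fun c => hasMoments_affineForm 0 c
  have e : ∀ z, conj (affineForm a b z) * affineForm a' b' z =
      (conj a * a' + affineForm 0 b' z * conj a + conj (affineForm 0 b z) * a') +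
        ∑ s, ∑ t, conj (b s) * b' t * (conj (z s) * z t) := by
    intro z
    have : ∑ s, ∑ t, conj (b s) * b' t * (conj (z s) * z t)
        = (∑ s, conj (b s) * conj (z s)) * ∑ t, b' t * z t := by
      rw [Finset.sum_mul_sum]
      refine Finset.sum_congr rfl fun s _ => Finset.sum_congr rfl fun t _ => by ring
    rw [this]
    simp only [affineForm, map_add, map_sum, map_mul, zero_add]
    ring
  simp only [e]
  rw [integral_add, integral_add, integral_add, hb, hb', integral_finsetSum]
  · have : ∀ s, ∫ z, ∑ t, conj (b s) * b' t * (conj (z s) * z t)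
        ∂Measure.pi (fun i => complexGaussian (v i)) = conj (b s) * b' s * v s := by
      intro s
      rw [integral_finsetSum _ fun t _ => hc s t]
      simp [integral_const_mul, integral_pi_covariance hv]
    simp [this]
  · exact fun s _ => integrable_finsetSum _ fun t _ => hc s t
  · exact integrable_const _
  · exact ((hm b').integrable).mul_const _
  · exact (integrable_const _).add (((hm b').integrable).mul_const _)
  · exact ((hm b).conj.integrable).mul_const _
  · exact ((integrable_const _).add (((hm b').integrable).mul_const _)).add
      (((hm b).conj.integrable).mul_const _)
  · exact integrable_finsetSum _ fun s _ => integrable_finsetSum _ fun t _ => hc s t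

theorem dependsOn_affineForm (a : ℂ) {b : ι → ℂ} {S : Set ι} (hb : ∀ s ∉ S, b s = 0) :
    DependsOn (affineForm a b) S := by
  intro z z' hz
  unfold affineForm
  congr 1
  refine Finset.sum_congr rfl fun s _ => ?_
  by_cases hs : s ∈ S
  · rw [hz s hs]
  · rw [hb s hs, zero_mul, zero_mul]

/-- The channels are a product over APs of products over UEs; flattening the index makes the
single-index Wick formula available. -/
theorem map_uncurry_pi {m n : Type*} [Fintype m] [Fintype n] (ν : m → n → Measure ℂ)
    [∀ i j, IsProbabilityMeasure (ν i j)] :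
    (Measure.pi (fun i => Measure.pi (ν i))).map (fun h (x : m × n) => h x.1 x.2)
      = Measure.pi (fun x : m × n => ν x.1 x.2) := by
  refine (Measure.pi_eq fun s hs => ?_).symm
  rw [Measure.map_apply (by fun_prop) (MeasurableSet.univ_pi hs)]
  have : (fun (h : m → n → ℂ) (x : m × n) => h x.1 x.2) ⁻¹' Set.univ.pi s
      = Set.univ.pi fun i => Set.univ.pi fun j => s (i, j) := by
    ext h
    simp [Set.mem_pi]
  rw [this, Measure.pi_pi]
  simp_rw [Measure.pi_pi]
  rw [Fintype.prod_prod_type]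

end PiGaussian

/-! ### Variational lower bound for the divergence -/

section Gibbs

/-- Fenchel–Young inequality for x log x - x + 1: multiply e^u ≥ 1 + u by x at u = y - log x. -/
theorem le_klFun {x : ℝ} (hx : 0 ≤ x) (y : ℝ) : x * y - Real.exp y + 1 ≤ klFun x := by
  rw [klFun_apply]
  rcases hx.eq_or_lt with rfl | hx
  · simp [(Real.exp_pos y).le]
  · have h := mul_le_mul_of_nonneg_left (Real.add_one_le_exp (y - Real.log x)) hx.le
    rw [Real.exp_sub, Real.exp_log hx, mul_div_cancel₀ _ hx.ne'] at h
    linarith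

/-- Donsker–Varadhan lower bound for the Kullback–Leibler divergence. -/
theorem ofReal_integral_le_klDiv {α : Type*} [MeasurableSpace α] {ν μ : Measure α}
    [IsProbabilityMeasure ν] [IsProbabilityMeasure μ] {F : α → ℝ} (hF : Measurable F)
    (hFν : Integrable F ν) (hexp : ∫⁻ x, ENNReal.ofReal (Real.exp (F x)) ∂μ ≤ 1) :
    ENNReal.ofReal (∫ x, F x ∂ν) ≤ klDiv ν μ := by
  by_cases htop : klDiv ν μ = ∞
  · simp [htop]
  obtain ⟨hac, hint⟩ := klDiv_ne_top_iff.1 htop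
  have hE : Integrable (fun x => Real.exp (F x)) μ := by
    refine ⟨hF.exp.aestronglyMeasurable, ?_⟩
    rw [hasFiniteIntegral_iff_ofReal (Filter.Eventually.of_forall fun x => (Real.exp_pos _).le)]
    exact hexp.trans_lt ENNReal.one_lt_top
  have hE1 : ∫ x, Real.exp (F x) ∂μ ≤ 1 := by
    rw [integral_eq_lintegral_of_nonneg_ae
      (Filter.Eventually.of_forall fun x => (Real.exp_pos _).le) hF.exp.aestronglyMeasurable]
    exact ENNReal.toReal_le_of_le_ofReal zero_le_one (by simpa using hexp)
  have hρ : Integrable (fun x => (ν.rnDeriv μ x).toReal • F x) μ :=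
    (integrable_rnDeriv_smul_iff hac).2 hFν
  refine ENNReal.ofReal_le_of_le_toReal ?_
  rw [toReal_klDiv_eq_integral_klFun hac, ← integral_rnDeriv_smul hac]
  have hk := (integrable_klFun_rnDeriv_iff hac).2 hint
  -- Fenchel–Young is applied pointwise with x = dν/dμ and y = F. After integration, 1 - ∫ exp F is
  -- nonnegative and can be dropped.
  have h := integral_mono ((hρ.sub hE).add (integrable_const 1)) hk
    (fun x => le_klFun ENNReal.toReal_nonneg (F x))
  have h' := integral_add (hρ.sub hE) (integrable_const (1 : ℝ))
  have h'' := integral_sub hρ hE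
  simp only [Pi.add_apply, Pi.sub_apply, integral_const, probReal_univ, smul_eq_mul,
    mul_one] at h h' h''
  rw [h', h''] at h
  simp only [smul_eq_mul] at h ⊢
  linarith

end Gibbs

/-! ### Gaussian test channel and achievable rate -/

section TestChannel

/-- Multiplied by the density of N(0, 1/2), the integrand is the density of N(b, v/2). -/
theorem integral_exp_gaussianReal {v : ℝ} (hv : 0 < v) (b : ℝ) :
    ∫ x, (√v)⁻¹ * Real.exp (x ^ 2 - (x - b) ^ 2 / v) ∂gaussianReal 0 ((1 : ℝ) / 2).toNNReal
      = 1 := by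
  have h0 : ((1 : ℝ) / 2).toNNReal ≠ 0 := by simp
  have h1 : (v / 2).toNNReal ≠ 0 := by simpa using hv
  rw [integral_gaussianReal_eq_integral_smul h0]
  refine Eq.trans ?_ (integral_gaussianPDFReal_eq_one b h1)
  congr 1
  ext x
  simp only [gaussianPDFReal, smul_eq_mul]
  rw [Real.coe_toNNReal _ (by positivity), Real.coe_toNNReal _ (by positivity)]
  have e1 : 2 * Real.pi * (v / 2) = Real.pi * v := by ring
  have e2 : 2 * Real.pi * (1 / 2) = Real.pi := by ring
  rw [e1, e2, Real.sqrt_mul Real.pi_pos.le, mul_inv, mul_mul_mul_comm,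
    ← Real.exp_add]
  congr 2
  field_simp
  ring

theorem integral_exp_complexGaussian {v : ℝ} (hv : 0 < v) (b : ℂ) :
    ∫ x, Real.exp (-Real.log v - ‖x - b‖ ^ 2 / v + ‖x‖ ^ 2) ∂complexGaussian 1 = 1 := by
  have e : ∀ x : ℂ, Real.exp (-Real.log v - ‖x - b‖ ^ 2 / v + ‖x‖ ^ 2)
      = ((√v)⁻¹ * Real.exp (x.re ^ 2 - (x.re - b.re) ^ 2 / v)) *
        ((√v)⁻¹ * Real.exp (x.im ^ 2 - (x.im - b.im) ^ 2 / v)) := by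
    intro x
    rw [mul_mul_mul_comm, ← mul_inv, Real.mul_self_sqrt hv.le, ← Real.exp_add, sub_add,
      sub_eq_add_neg, Real.exp_add, Real.exp_neg, Real.exp_log hv, ← Complex.normSq_eq_norm_sq,
      ← Complex.normSq_eq_norm_sq, Complex.normSq_apply, Complex.normSq_apply]
    congr 2
    simp only [Complex.sub_re, Complex.sub_im]
    ring
  simp only [e]
  unfold complexGaussian
  rw [integral_map_equiv]
  simp only [Complex.measurableEquivRealProd_symm_apply]
  rw [integral_prod_mul (fun x : ℝ => (√v)⁻¹ * Real.exp (x ^ 2 - (x - b.re) ^ 2 / v))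
    (fun x : ℝ => (√v)⁻¹ * Real.exp (x ^ 2 - (x - b.im) ^ 2 / v)),
    integral_exp_gaussianReal hv, integral_exp_gaussianReal hv, mul_one]

/-- Log-likelihood ratio between the Gaussian backward channel with mean `a * r` and error
variance `v`, and the input law `CN(0, 1)`. -/
def backwardLogRatio {T : ℕ} (v : ℝ) (a : ℂ) (x r : Fin T → ℂ) : ℝ :=
  ∑ t, (-Real.log v - ‖x t - a * r t‖ ^ 2 / v + ‖x t‖ ^ 2)

theorem lintegral_exp_backwardLogRatio {T : ℕ} {v : ℝ} (hv : 0 < v) (a : ℂ) (r : Fin T → ℂ) :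
    ∫⁻ x, ENNReal.ofReal (Real.exp (backwardLogRatio v a x r))
      ∂Measure.pi (fun _ : Fin T => complexGaussian 1) = 1 := by
  have h1 : ∫ x, Real.exp (backwardLogRatio v a x r)
      ∂Measure.pi (fun _ : Fin T => complexGaussian 1) = 1 := by
    simp only [backwardLogRatio, Real.exp_sum]
    rw [integral_fintype_prod_eq_prod (𝕜 := ℝ) (fun t x =>
      Real.exp (-Real.log v - ‖x - a * r t‖ ^ 2 / v + ‖x‖ ^ 2))]
    simp [integral_exp_complexGaussian hv]
  rw [← ofReal_integral_eq_lintegral_ofReal (integrable_of_integral_eq_one h1)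
    (Filter.Eventually.of_forall fun x => (Real.exp_pos _).le), h1, ENNReal.ofReal_one]

theorem measurable_backwardLogRatio {T : ℕ} (v : ℝ) (a : ℂ) :
    Measurable (fun z : (Fin T → ℂ) × (Fin T → ℂ) => backwardLogRatio v a z.1 z.2) := by
  unfold backwardLogRatio
  fun_prop

theorem ofReal_integral_norm_sq {α : Type*} [MeasurableSpace α] {μ : Measure α} (f : α → ℂ) :
    ((∫ x, ‖f x‖ ^ 2 ∂μ : ℝ) : ℂ) = ∫ x, conj (f x) * f x ∂μ := by
  rw [← integral_complex_ofReal]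
  simp only [Complex.conj_mul', Complex.ofReal_pow]

theorem integral_norm_sq_input {T : ℕ} (t : Fin T) :
    Integrable (fun x : Fin T → ℂ => ‖x t‖ ^ 2) (Measure.pi fun _ : Fin T => complexGaussian 1) ∧
      ∫ x, ‖x t‖ ^ 2 ∂(Measure.pi fun _ : Fin T => complexGaussian 1) = 1 := by
  constructor
  · have h2 : MemLp (fun x : Fin T → ℂ => x t) 2 (Measure.pi fun _ : Fin T => complexGaussian 1) :=
      hasMoments_coord (v := fun _ => 1) t 2
    exact h2.integrable_norm_pow (by norm_num)
  · have h := integral_pi_covariance (v := fun _ : Fin T => (1 : ℝ)) (fun _ => zero_le_one) t t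
    rw [← ofReal_integral_norm_sq, if_pos rfl] at h
    exact_mod_cast h

/-- Achievable rate with i.i.d. Gaussian inputs of a channel whose linear estimation error of the
input from the output has power at most `v`. -/
theorem ofReal_mul_log_le_mutualInfo {T : ℕ} {Ω : Type*} [MeasurableSpace Ω] (μ : Measure Ω)
    [IsProbabilityMeasure μ] {f : (Fin T → ℂ) → Ω → (Fin T → ℂ)}
    (hf : Measurable (fun z : (Fin T → ℂ) × Ω => f z.1 z.2)) {v : ℝ} (hv : 0 < v) (a : ℂ)
    (hint : ∀ t, Integrable (fun z : (Fin T → ℂ) × Ω => ‖z.1 t - a * f z.1 z.2 t‖ ^ 2)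
      ((Measure.pi (fun _ : Fin T => complexGaussian 1)).prod μ))
    (herr : ∀ t, ∫ z : (Fin T → ℂ) × Ω, ‖z.1 t - a * f z.1 z.2 t‖ ^ 2
      ∂((Measure.pi (fun _ : Fin T => complexGaussian 1)).prod μ) = v) :
    ENNReal.ofReal (T * -Real.log v) ≤
      mutualInfo (((Measure.pi (fun _ : Fin T => complexGaussian 1)).prod μ).map
        (fun z => (z.1, f z.1 z.2))) := by
  set P := Measure.pi (fun _ : Fin T => complexGaussian 1) with hP
  have hg : Measurable (fun z : (Fin T → ℂ) × Ω => (z.1, f z.1 z.2)) := by fun_prop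
  set ν := (P.prod μ).map (fun z => (z.1, f z.1 z.2)) with hν
  have : IsProbabilityMeasure ν := Measure.isProbabilityMeasure_map hg.aemeasurable
  have hfst : ν.fst = P := by
    rw [hν, Measure.fst_map_prodMk (by fun_prop)]
    exact Measure.fst_prod
  have hx : ∀ t, Integrable (fun z : (Fin T → ℂ) × Ω => ‖z.1 t‖ ^ 2) (P.prod μ) :=
    fun t => (integral_norm_sq_input t).1.comp_fst μ
  have hx1 : ∀ t, ∫ z : (Fin T → ℂ) × Ω, ‖z.1 t‖ ^ 2 ∂(P.prod μ) = 1 := by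
    intro t
    rw [integral_fun_fst (fun x : Fin T → ℂ => ‖x t‖ ^ 2), hP, (integral_norm_sq_input t).2]
    simp
  have hterm : ∀ t ∈ Finset.univ, Integrable (fun z : (Fin T → ℂ) × Ω =>
      (-Real.log v - ‖z.1 t - a * f z.1 z.2 t‖ ^ 2 / v + ‖z.1 t‖ ^ 2)) (P.prod μ) :=
    fun t _ => ((integrable_const _).sub ((hint t).div_const v)).add (hx t)
  have hF := measurable_backwardLogRatio (T := T) v a
  have hFν : Integrable (fun z => backwardLogRatio v a z.1 z.2) ν := by
    rw [hν, integrable_map_measure hF.aestronglyMeasurable hg.aemeasurable]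
    exact integrable_finsetSum _ hterm
  have hval : ∫ z, backwardLogRatio v a z.1 z.2 ∂ν = T * -Real.log v := by
    rw [hν, integral_map hg.aemeasurable hF.aestronglyMeasurable]
    unfold backwardLogRatio
    rw [integral_finsetSum _ hterm]
    -- Error power v and unit input power make the last two terms cancel: -v/v + 1 = 0.
    have : ∀ t, ∫ z : (Fin T → ℂ) × Ω, (-Real.log v - ‖z.1 t - a * f z.1 z.2 t‖ ^ 2 / v
        + ‖z.1 t‖ ^ 2) ∂(P.prod μ) = -Real.log v := by
      intro t
      rw [integral_add (by exact (integrable_const _).sub ((hint t).div_const v)) (hx t),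
        integral_sub (integrable_const _) ((hint t).div_const v), integral_div, herr t, hx1 t,
        div_self hv.ne']
      simp
    simp [this]
  rw [← hval]
  unfold mutualInfo
  rw [hfst]
  refine ofReal_integral_le_klDiv hF hFν ?_
  -- Integrating over x first, with r fixed, gives 1 for every r, so the marginal law of the output
  -- plays no role.
  rw [lintegral_prod_symm' _ (by fun_prop)]
  simp [hP, lintegral_exp_backwardLogRatio hv a]

end TestChannel

/-! ### Laws of channels and sources, fourth-order channel moments -/

section

variable {M K τ T : ℕ}

/-- The admissible ranges of the parameters. -/
structure Params.Admissible (p : Params M K τ) : Prop where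
  β_pos : ∀ m k, 0 < p.β m k
  γ_mem : ∀ k, 0 ≤ p.γ k ∧ p.γ k ≤ 1
  φ_unit : ∀ k, ‖p.φ k‖ = 1
  κt_mem : 0 < p.κt ∧ p.κt ≤ 1
  κr_mem : 0 < p.κr ∧ p.κr ≤ 1
  ρp_pos : 0 < p.ρp
  ρu_pos : 0 < p.ρu
  σ2_pos : 0 < p.σ2

section Law

theorem Params.condVar_nonneg {p : Params M K τ} (hp : p.Admissible) (h : Fin M → Fin K → ℂ)
    (s : Source M K τ T) : 0 ≤ p.condVar h s := by
  have h1 := hp.κt_mem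
  have h2 := hp.κr_mem
  have h3 := hp.ρp_pos
  have h4 := hp.ρu_pos
  have h5 := hp.σ2_pos
  have h6 : 0 ≤ 1 - p.κt := by linarith
  have h7 : 0 ≤ 1 - p.κr := by linarith
  have h8 := fun k => (hp.γ_mem k).1
  cases s with
  | rxData m t =>
    have : 0 ≤ ∑ k, p.γ k * ‖h m k‖ ^ 2 :=
      Finset.sum_nonneg fun k _ => mul_nonneg (h8 k) (sq_nonneg _)
    simp only [Params.condVar]
    positivity
  | txData k t =>
    have := h8 k
    simp only [Params.condVar]
    positivity
  | _ => simp only [Params.condVar]; positivity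

/-- The law of the channels. -/
def Params.channelLaw (p : Params M K τ) : Measure (Fin M → Fin K → ℂ) :=
  Measure.pi (fun m => Measure.pi (fun k => complexGaussian (p.β m k)))

instance (p : Params M K τ) : IsProbabilityMeasure p.channelLaw := by
  unfold Params.channelLaw
  infer_instance

/-- The conditional law of all other random quantities given the channels. -/
def Params.sourceLaw (p : Params M K τ) (T : ℕ) (h : Fin M → Fin K → ℂ) :
    Measure (Source M K τ T → ℂ) :=
  Measure.pi (fun s => complexGaussian (p.condVar h s))

instance (p : Params M K τ) (h : Fin M → Fin K → ℂ) : IsProbabilityMeasure (p.sourceLaw T h) := by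
  unfold Params.sourceLaw
  infer_instance

variable {p : Params M K τ}

theorem hasMoments_channelLaw (m : Fin M) (k : Fin K) :
    HasMoments (fun h => h m k) p.channelLaw := by
  have h1 := (hasMoments_complexGaussian (p.β m k)).pi_eval
    (ν := fun k => complexGaussian (p.β m k))
  unfold Params.channelLaw
  refine HasMoments.comp_map (f := fun x : Fin K → ℂ => x k) (measurable_pi_apply m) ?_
  rwa [(measurePreserving_eval
    (fun m => Measure.pi (fun k => complexGaussian (p.β m k))) m).map_eq]

theorem integral_channelLaw (F : (Fin M × Fin K → ℂ) → ℂ) (hF : Measurable F) :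
    ∫ h, F (fun x => h x.1 x.2) ∂p.channelLaw =
      ∫ u, F u ∂Measure.pi (fun x : Fin M × Fin K => complexGaussian (p.β x.1 x.2)) := by
  unfold Params.channelLaw
  rw [← map_uncurry_pi (fun m k => complexGaussian (p.β m k)),
    integral_map (Measurable.aemeasurable (by fun_prop)) hF.aestronglyMeasurable]

theorem integral_channel_covariance (hβ : ∀ m k, 0 ≤ p.β m k) (m m' : Fin M) (l l' : Fin K) :
    ∫ h, conj (h m' l) * h m l' ∂p.channelLaw =
      if m' = m ∧ l = l' then (p.β m l : ℂ) else 0 := by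
  have h := integral_channelLaw (p := p) (fun u => conj (u (m', l)) * u (m, l')) (by fun_prop)
  rw [integral_pi_covariance (v := fun x : Fin M × Fin K => p.β x.1 x.2)
    (fun x => hβ x.1 x.2)] at h
  rw [h]
  by_cases hm : m' = m
  · subst hm; simp [Prod.ext_iff]
  · simp [Prod.ext_iff, hm]

/-- One pairing forces equal APs; the other constrains only the UE indices and survives for m' ≠ m.
The latter produces the coherent term C. -/
theorem integral_channel_wick (hβ : ∀ m k, 0 ≤ p.β m k) (m m' : Fin M) (l l' j : Fin K) :
    ∫ h, conj (h m' l) * h m l' * (h m' j * conj (h m j)) ∂p.channelLaw =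
      (if m' = m ∧ l = l' then (p.β m l : ℂ) * p.β m j else 0) +
        (if l = j ∧ l' = j then (p.β m' j : ℂ) * p.β m j else 0) := by
  have h := integral_channelLaw (p := p)
    (fun u => conj (u (m', l)) * u (m, l') * (u (m', j) * conj (u (m, j)))) (by fun_prop)
  rw [integral_pi_wick (v := fun x : Fin M × Fin K => p.β x.1 x.2) (fun x => hβ x.1 x.2)] at h
  rw [h]
  congr 1
  · by_cases hm : m' = m
    · subst hm; simp [Prod.ext_iff]
    · simp [Prod.ext_iff, hm]
  · by_cases hl : l = j
    · subst hl
      by_cases hl' : l' = l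
      · subst hl'; simp
      · simp [hl']
    · simp [hl]

theorem integral_add_mul_add {α : Type*} [MeasurableSpace α] {μ : Measure α}
    [IsProbabilityMeasure μ] {A B : α → ℂ} (hA : HasMoments A μ) (hB : HasMoments B μ) (e e' : ℂ) :
    ∫ x, (A x + e) * (B x + e') ∂μ =
      ((∫ x, A x * B x ∂μ) + e * ∫ x, B x ∂μ) + ((∫ x, A x ∂μ) * e' + e * e') := by
  have h1 : ∀ x, (A x + e) * (B x + e') = (A x * B x + e * B x) + (A x * e' + e * e') :=
    fun x => by ring
  simp only [h1]
  have i1 := (hA.mul hB).integrable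
  have i2 := hB.integrable.const_mul e
  have i3 := hA.integrable.mul_const e'
  have i4 : Integrable (fun _ : α => e * e') μ := integrable_const _
  rw [integral_add (by exact i1.add i2) (by exact i3.add i4), integral_add i1 i2,
    integral_add i3 i4, integral_const_mul, integral_mul_const, integral_const]
  simp

/-- Mean of the product of two Hermitian forms in the channels of two APs. -/
theorem integral_channel_forms (hβ : ∀ m k, 0 ≤ p.β m k) (m m' : Fin M)
    (s : Fin K → Fin K → ℂ) (q : Fin K → ℂ) (e e' : ℂ) :
    ∫ h, ((∑ l, ∑ l', conj (h m' l) * h m l' * s l l') + if m' = m then e else 0) *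
        ((∑ j, conj (h m j) * h m' j * q j) + if m' = m then e' else 0) ∂p.channelLaw =
      (∑ j, s j j * q j * (p.β m' j * p.β m j)) +
        if m' = m then ((∑ l, s l l * p.β m l) + e) * ((∑ j, q j * p.β m j) + e') else 0 := by
  have hc : ∀ l l', HasMoments (fun h => conj (h m' l) * h m l') p.channelLaw :=
    fun l l' => (hasMoments_channelLaw m' l).conj.mul (hasMoments_channelLaw m l')
  have hd : ∀ j, HasMoments (fun h => conj (h m j) * h m' j) p.channelLaw :=
    fun j => (hasMoments_channelLaw m j).conj.mul (hasMoments_channelLaw m' j)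
  have hcs : ∀ l l', HasMoments (fun h => conj (h m' l) * h m l' * s l l') p.channelLaw :=
    fun l l' => (hc l l').mul (hasMoments_const _)
  have hdq : ∀ j, HasMoments (fun h => conj (h m j) * h m' j * q j) p.channelLaw :=
    fun j => (hd j).mul (hasMoments_const _)
  have hA := HasMoments.sum Finset.univ fun l _ =>
    HasMoments.sum Finset.univ fun l' _ => hcs l l'
  have hB := HasMoments.sum Finset.univ fun j _ => hdq j
  have hAB : ∫ h, (∑ l, ∑ l', conj (h m' l) * h m l' * s l l') *
      (∑ j, conj (h m j) * h m' j * q j) ∂p.channelLaw =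
      (∑ j, s j j * q j * (p.β m' j * p.β m j)) +
        if m' = m then (∑ l, s l l * p.β m l) * (∑ j, q j * p.β m j) else 0 := by
    have e1 : ∀ h : Fin M → Fin K → ℂ, (∑ l, ∑ l', conj (h m' l) * h m l' * s l l') *
        (∑ j, conj (h m j) * h m' j * q j) = ∑ l, ∑ l', ∑ j, s l l' * q j *
          (conj (h m' l) * h m l' * (h m' j * conj (h m j))) := by
      intro h
      rw [Finset.sum_mul]
      simp only [Finset.sum_mul_sum]
      refine Finset.sum_congr rfl fun l _ => Finset.sum_congr rfl fun l' _ =>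
        Finset.sum_congr rfl fun j _ => by ring
    have hi : ∀ l l' j, Integrable (fun h => s l l' * q j *
        (conj (h m' l) * h m l' * (h m' j * conj (h m j)))) p.channelLaw := fun l l' j =>
      ((hc l l').mul ((hasMoments_channelLaw m' j).mul
        (hasMoments_channelLaw m j).conj)).integrable.const_mul _
    simp only [e1]
    rw [integral_finsetSum _ fun l _ => integrable_finsetSum _ fun l' _ =>
      integrable_finsetSum _ fun j _ => hi l l' j]
    have e2 : ∀ l, ∫ h, ∑ l', ∑ j, s l l' * q j *
        (conj (h m' l) * h m l' * (h m' j * conj (h m j))) ∂p.channelLaw =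
        ∑ l', ∑ j, s l l' * q j * ((if m' = m ∧ l = l' then (p.β m l : ℂ) * p.β m j else 0) +
        (if l = j ∧ l' = j then (p.β m' j : ℂ) * p.β m j else 0)) := by
      intro l
      rw [integral_finsetSum _ fun l' _ => integrable_finsetSum _ fun j _ => hi l l' j]
      refine Finset.sum_congr rfl fun l' _ => ?_
      rw [integral_finsetSum _ fun j _ => hi l l' j]
      refine Finset.sum_congr rfl fun j _ => ?_
      rw [integral_const_mul, integral_channel_wick hβ]
    simp only [e2, mul_add, Finset.sum_add_distrib]
    rw [add_comm]
    congr 1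
    · simp [ite_and, mul_ite]
    · by_cases hm : m' = m
      · simp only [hm, true_and, if_true, mul_ite, mul_zero]
        rw [Finset.sum_mul_sum]
        refine Finset.sum_congr rfl fun l _ => ?_
        rw [Finset.sum_comm]
        refine Finset.sum_congr rfl fun j _ => ?_
        rw [Finset.sum_ite_eq]
        simp only [Finset.mem_univ, if_true]
        ring
      · simp [hm]
  have hAi : ∫ h, ∑ l, ∑ l', conj (h m' l) * h m l' * s l l' ∂p.channelLaw =
      if m' = m then ∑ l, s l l * p.β m l else 0 := by
    rw [integral_finsetSum _ fun l _ => integrable_finsetSum _ fun l' _ => (hcs l l').integrable]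
    have e2 : ∀ l, ∫ h, ∑ l', conj (h m' l) * h m l' * s l l' ∂p.channelLaw =
        if m' = m then s l l * p.β m l else 0 := by
      intro l
      rw [integral_finsetSum _ fun l' _ => (hcs l l').integrable]
      simp only [integral_mul_const, integral_channel_covariance hβ]
      by_cases hm : m' = m <;> simp [hm, mul_comm]
    simp only [e2]
    by_cases hm : m' = m <;> simp [hm]
  have hBi : ∫ h, ∑ j, conj (h m j) * h m' j * q j ∂p.channelLaw =
      if m' = m then ∑ j, q j * p.β m j else 0 := by
    rw [integral_finsetSum _ fun j _ => (hdq j).integrable]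
    simp only [integral_mul_const, integral_channel_covariance hβ]
    by_cases hm : m' = m
    · simp [hm, mul_comm]
    · simp [hm, Ne.symm hm]
  refine (integral_add_mul_add hA hB _ _).trans ?_
  rw [hAB, hAi, hBi]
  by_cases hm : m' = m
  · simp [hm]
    ring
  · simp [hm]

end Law

end

/-! ### Disintegration over the channels, finiteness of moments -/

section

variable {M K τ T : ℕ} {Ω : Type*} [MeasurableSpace Ω]

section Model

variable {p : Params M K τ} {μ : Measure Ω} [IsProbabilityMeasure μ]
  {g : Fin M → Fin K → Ω → ℂ} {Z : Source M K τ T → Ω → ℂ}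

theorem IsUplinkModel.map_channel (hm : IsUplinkModel p μ g Z) :
    μ.map (fun ω m k => g m k ω) = p.channelLaw := hm.channel_law

theorem IsUplinkModel.condDistrib_eq (hm : IsUplinkModel p μ g Z) :
    ∀ᵐ h ∂p.channelLaw,
      condDistrib (fun ω s => Z s ω) (fun ω m k => g m k ω) μ h = p.sourceLaw T h := by
  rw [← hm.map_channel]
  exact hm.conditional_law

theorem IsUplinkModel.measurable_channels (hm : IsUplinkModel p μ g Z) :
    Measurable (fun ω m k => g m k ω) :=
  measurable_pi_lambda _ fun m => measurable_pi_lambda _ fun k => hm.measurable_channel m k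

theorem IsUplinkModel.measurable_sources (hm : IsUplinkModel p μ g Z) :
    Measurable (fun ω s => Z s ω) :=
  measurable_pi_lambda _ fun s => hm.measurable_source s

theorem IsUplinkModel.map_joint (hm : IsUplinkModel p μ g Z) :
    p.channelLaw ⊗ₘ condDistrib (fun ω s => Z s ω) (fun ω m k => g m k ω) μ =
      μ.map (fun ω => ((fun m k => g m k ω), fun s => Z s ω)) := by
  rw [← hm.map_channel]
  exact compProd_map_condDistrib hm.measurable_sources.aemeasurable

/-- Tower property: the joint law is the composition of the channel law with the conditional law of
the sources, which is known almost everywhere. -/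
theorem IsUplinkModel.integral_eq (hm : IsUplinkModel p μ g Z)
    {F : (Fin M → Fin K → ℂ) × (Source M K τ T → ℂ) → ℂ} (hF : Measurable F)
    (hint : Integrable (fun ω => F ((fun m k => g m k ω), fun s => Z s ω)) μ) :
    ∫ ω, F ((fun m k => g m k ω), fun s => Z s ω) ∂μ =
      ∫ h, ∫ z, F (h, z) ∂p.sourceLaw T h ∂p.channelLaw := by
  have hj : Measurable (fun ω => ((fun m k => g m k ω), fun s => Z s ω)) :=
    hm.measurable_channels.prodMk hm.measurable_sources
  have h1 := (integrable_map_measure hF.aestronglyMeasurable hj.aemeasurable).2 hint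
  rw [← integral_map hj.aemeasurable hF.aestronglyMeasurable]
  rw [← hm.map_joint] at h1 ⊢
  rw [Measure.integral_compProd h1]
  refine integral_congr_ae ?_
  filter_upwards [hm.condDistrib_eq] with h hh
  rw [hh]

/-- This version needs no integrability, so it can establish the finite moments that `integral_eq`
later requires. -/
theorem IsUplinkModel.lintegral_eq (hm : IsUplinkModel p μ g Z)
    {F : (Fin M → Fin K → ℂ) × (Source M K τ T → ℂ) → ℝ≥0∞} (hF : Measurable F) :
    ∫⁻ ω, F ((fun m k => g m k ω), fun s => Z s ω) ∂μ =
      ∫⁻ h, ∫⁻ z, F (h, z) ∂p.sourceLaw T h ∂p.channelLaw := by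
  have hj : Measurable (fun ω => ((fun m k => g m k ω), fun s => Z s ω)) :=
    hm.measurable_channels.prodMk hm.measurable_sources
  rw [← lintegral_map hF hj, ← hm.map_joint, Measure.lintegral_compProd hF]
  refine lintegral_congr_ae ?_
  filter_upwards [hm.condDistrib_eq] with h hh
  rw [hh]

theorem IsUplinkModel.hasMoments_channel (hm : IsUplinkModel p μ g Z) (m : Fin M) (k : Fin K) :
    HasMoments (g m k) μ :=
  HasMoments.comp_map (f := fun h : Fin M → Fin K → ℂ => h m k) hm.measurable_channels
    (by rw [hm.map_channel]; exact hasMoments_channelLaw m k)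

theorem lintegral_enorm_pow_complexGaussian (v : ℝ) (n : ℕ) :
    ∫⁻ z, ‖z‖ₑ ^ n ∂complexGaussian v =
      ‖(√v : ℂ)‖ₑ ^ n * ∫⁻ z, ‖z‖ₑ ^ n ∂complexGaussian 1 := by
  rw [complexGaussian_eq_map_one v, lintegral_map (by fun_prop) (by fun_prop)]
  simp only [enorm_mul, mul_pow]
  rw [lintegral_const_mul _ (by fun_prop)]

theorem lintegral_enorm_pow_lt_top {α : Type*} [MeasurableSpace α] {μ : Measure α} {f : α → ℂ}
    (n : ℕ) [IsFiniteMeasure μ] (hf : HasMoments f μ) : ∫⁻ x, ‖f x‖ₑ ^ n ∂μ < ∞ := by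
  have := ((hf n).integrable_norm_pow').2
  simpa [HasFiniteIntegral, enorm_pow] using this

theorem hasMoments_of_lintegral_lt_top {α : Type*} [MeasurableSpace α] {μ : Measure α} {f : α → ℂ}
    (hf : Measurable f) (h : ∀ n : ℕ, ∫⁻ x, ‖f x‖ₑ ^ n ∂μ < ∞) : HasMoments f μ := by
  intro n
  rcases Nat.eq_zero_or_pos n with rfl | hn
  · simpa using hf.aestronglyMeasurable
  · refine ⟨hf.aestronglyMeasurable, ?_⟩
    rw [eLpNorm_lt_top_iff_lintegral_rpow_enorm_lt_top (by simpa using hn.ne') (by simp)]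
    simpa using h n

theorem measurable_condVar (s : Source M K τ T) : Measurable (fun h => p.condVar h s) := by
  cases s <;> simp only [Params.condVar] <;> fun_prop

theorem hasMoments_condVar (s : Source M K τ T) :
    HasMoments (fun h => (p.condVar h s : ℂ)) p.channelLaw := by
  have hn : ∀ m k, HasMoments (fun h => conj (h m k) * h m k) p.channelLaw := fun m k =>
    (hasMoments_channelLaw m k).conj.mul (hasMoments_channelLaw m k)
  cases s with
  | rxPilot m i =>
    simp only [Params.condVar]
    push_cast
    simp only [← Complex.conj_mul']
    exact (hasMoments_const _).mul (HasMoments.sum _ fun k _ => hn m k)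
  | rxData m i =>
    simp only [Params.condVar]
    push_cast
    simp only [← Complex.conj_mul']
    exact (hasMoments_const _).mul (HasMoments.sum _ fun k _ =>
      (hasMoments_const _).mul (hn m k))
  | _ => simp only [Params.condVar]; exact hasMoments_const _

theorem hasMoments_sqrt_condVar (s : Source M K τ T) :
    HasMoments (fun h => (√(p.condVar h s) : ℂ)) p.channelLaw := by
  have hme := (measurable_condVar (p := p) s).sqrt
  intro n
  refine ((memLp_const (1 : ℝ)).add (hasMoments_condVar (p := p) s n).norm).mono'
    (Complex.measurable_ofReal.comp hme).aestronglyMeasurable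
    (Filter.Eventually.of_forall fun h => ?_)
  simp only [Pi.add_apply, Complex.norm_real, Real.norm_eq_abs]
  rw [abs_of_nonneg (Real.sqrt_nonneg _)]
  refine Real.sqrt_le_iff.2 ⟨by positivity, ?_⟩
  nlinarith [le_abs_self (p.condVar h s), abs_nonneg (p.condVar h s),
    sq_nonneg (|p.condVar h s|)]

/-- Receiver distortions are Gaussian only conditionally. By scaling, the conditional n-th absolute
moment is a constant times (√condVar)^n, and `condVar` is polynomial in the channels and their
conjugates. -/
theorem IsUplinkModel.hasMoments_source (hm : IsUplinkModel p μ g Z) (s : Source M K τ T) :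
    HasMoments (Z s) μ := by
  refine hasMoments_of_lintegral_lt_top (hm.measurable_source s) fun n => ?_
  have h := hm.lintegral_eq (F := fun y => ‖y.2 s‖ₑ ^ n) (by fun_prop)
  refine h.trans_lt ?_
  have e : ∀ h : Fin M → Fin K → ℂ, ∫⁻ z, ‖z s‖ₑ ^ n ∂p.sourceLaw T h =
      ‖(√(p.condVar h s) : ℂ)‖ₑ ^ n * ∫⁻ z, ‖z‖ₑ ^ n ∂complexGaussian 1 := by
    intro h
    rw [← lintegral_enorm_pow_complexGaussian]
    unfold Params.sourceLaw
    rw [← (measurePreserving_eval (fun s => complexGaussian (p.condVar h s)) s).map_eq,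
      lintegral_map (by fun_prop) (by fun_prop)]
  simp only [e]
  rw [lintegral_mul_const' _ _
    (lintegral_enorm_pow_lt_top n (hasMoments_complexGaussian 1)).ne]
  exact ENNReal.mul_lt_top (lintegral_enorm_pow_lt_top n (hasMoments_sqrt_condVar s))
    (lintegral_enorm_pow_lt_top n (hasMoments_complexGaussian 1))

end Model

end

/-! ### Signals as affine forms in the sources, conditional covariances -/

section

variable {M K τ T : ℕ} {Ω : Type*}

theorem sum_source (F : Source M K τ T → ℂ) : ∑ s, F s =
    (∑ k, ∑ i, F (.txPilot k i)) + (∑ m, ∑ i, F (.rxPilot m i)) + (∑ m, ∑ i, F (.noisePilot m i)) +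
    (∑ k, ∑ t, F (.symbol k t)) + (∑ k, ∑ t, F (.txData k t)) + (∑ m, ∑ t, F (.rxData m t)) +
    (∑ m, ∑ t, F (.noiseData m t)) := by
  rw [← (sourceEquiv M K τ T).sum_comp]
  simp only [Fintype.sum_sum_type, Fintype.sum_prod_type, sourceEquiv, Equiv.coe_fn_mk]
  ring

section Signals

variable (p : Params M K τ) (g : Fin M → Fin K → Ω → ℂ) (Z : Source M K τ T → Ω → ℂ)

/-- Conditional mean of the despread pilot signal given the channels. -/
def despreadMean (h : Fin M → Fin K → ℂ) (m : Fin M) (k : Fin K) : ℂ :=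
  ∑ j, (√p.κr : ℂ) * (√(τ * p.ρp * p.κt) : ℂ) * inner ℂ (p.φ k) (p.φ j) * h m j

/-- Coefficients of the despread pilot signal as a linear form in the sources. -/
def despreadCoeff (h : Fin M → Fin K → ℂ) (m : Fin M) (k : Fin K) : Source M K τ T → ℂ
  | .txPilot j i => (√p.κr : ℂ) * h m j * conj (p.φ k i)
  | .rxPilot m' i => if m' = m then conj (p.φ k i) else 0
  | .noisePilot m' i => if m' = m then conj (p.φ k i) else 0
  | _ => 0

theorem despread_eq_affineForm (m : Fin M) (k : Fin K) (ω : Ω) :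
    despread p g Z m k ω = affineForm (despreadMean p (fun m k => g m k ω) m k)
      (despreadCoeff p (fun m k => g m k ω) m k) (fun s => Z s ω) := by
  unfold despread pilotSignal affineForm despreadMean
  rw [sum_source]
  simp only [despreadCoeff, mul_add, Finset.sum_add_distrib, zero_mul, Finset.sum_const_zero,
    add_zero, ite_mul, Finset.mul_sum, PiLp.inner_apply, RCLike.inner_apply, Finset.sum_mul]
  rw [Finset.sum_comm]
  have e1 : ∀ F : Fin M → Fin τ → ℂ, ∑ m', ∑ i, (if m' = m then F m' i else 0) = ∑ i, F m i := by
    intro F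
    rw [Finset.sum_comm]
    simp
  rw [e1 (fun m' i => conj (p.φ k i) * Z (.rxPilot m' i) ω),
    e1 (fun m' i => conj (p.φ k i) * Z (.noisePilot m' i) ω)]
  rw [Finset.sum_comm (f := fun (i : Fin τ) j => conj (p.φ k i) *
    ((√p.κr : ℂ) * g m j ω * Z (.txPilot j i) ω))]
  simp only [← add_assoc]
  congr 3
  · exact Finset.sum_congr rfl fun j _ => Finset.sum_congr rfl fun i _ => by ring
  · exact Finset.sum_congr rfl fun j _ => Finset.sum_congr rfl fun i _ => by ring

/-- Conditional mean of a data sample given the channels and the symbol `x` of UE `k`. -/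
def dataMean (h : Fin M → Fin K → ℂ) (k : Fin K) (x : ℂ) (m : Fin M) : ℂ :=
  (√p.κr : ℂ) * (√(p.ρu * p.γ k * p.κt) : ℂ) * x * h m k

/-- Coefficients of a data sample as an affine form in the sources. -/
def dataCoeff (h : Fin M → Fin K → ℂ) (k : Fin K) (m : Fin M) (t : Fin T) : Source M K τ T → ℂ
  | .symbol j t' => if t' = t then
      if j = k then 0 else (√p.κr : ℂ) * (√(p.ρu * p.γ j * p.κt) : ℂ) * h m j else 0
  | .txData j t' => if t' = t then (√p.κr : ℂ) * h m j else 0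
  | .rxData m' t' => if m' = m ∧ t' = t then 1 else 0
  | .noiseData m' t' => if m' = m ∧ t' = t then 1 else 0
  | _ => 0

/-- The symbol of UE k is the deterministic x, so it enters through the mean and its source has
coefficient 0. -/
theorem dataSignal_eq_affineForm (k : Fin K) (x : Fin T → ℂ) (m : Fin M) (t : Fin T) (ω : Ω) :
    dataSignal p g Z k x m t ω = affineForm (dataMean p (fun m k => g m k ω) k (x t) m)
      (dataCoeff p (fun m k => g m k ω) k m t) (fun s => Z s ω) := by
  unfold dataSignal affineForm dataMean
  rw [sum_source]
  simp only [dataCoeff, zero_mul, Finset.sum_const_zero, ite_mul, one_mul, ite_and,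
    Finset.sum_ite_eq', Finset.mem_univ, if_true, Finset.sum_ite_irrel]
  simp only [← add_assoc, add_zero, mul_add, Finset.sum_add_distrib]
  congr 3
  -- The term j = k is isolated on both sides: on one it is the mean, on the other it vanishes.
  rw [← Finset.add_sum_erase _ _ (Finset.mem_univ k),
    ← Finset.add_sum_erase (a := k) (f := fun j => if j = k then (0 : ℂ) else
      (√p.κr : ℂ) * (√(p.ρu * p.γ j * p.κt) : ℂ) * g m j ω * Z (.symbol j t) ω) _
      (Finset.mem_univ k)]
  simp only [if_true, zero_add]
  congr 1
  · ring
  · refine Finset.sum_congr rfl fun j hj => ?_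
    rw [if_neg (Finset.ne_of_mem_erase hj), if_neg (Finset.ne_of_mem_erase hj)]
    ring

variable {g Z} [MeasurableSpace Ω]

theorem measurable_despread (hg : ∀ m k, Measurable (g m k)) (hZ : ∀ s, Measurable (Z s))
    (m : Fin M) (k : Fin K) : Measurable (despread p g Z m k) := by
  unfold despread pilotSignal
  fun_prop

theorem measurable_dataSignal (hg : ∀ m k, Measurable (g m k)) (hZ : ∀ s, Measurable (Z s))
    (k : Fin K) (m : Fin M) (t : Fin T) :
    Measurable (fun z : (Fin T → ℂ) × Ω => dataSignal p g Z k z.1 m t z.2) := by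
  unfold dataSignal
  refine Measurable.add (Measurable.add (Finset.measurable_sum _ fun j _ => ?_) (by fun_prop))
    (by fun_prop)
  by_cases hj : j = k <;> simp only [hj, if_true, if_false] <;> fun_prop

variable {μ : Measure Ω} [IsProbabilityMeasure μ]

theorem hasMoments_despread (hg : ∀ m k, HasMoments (g m k) μ) (hZ : ∀ s, HasMoments (Z s) μ)
    (m : Fin M) (k : Fin K) : HasMoments (despread p g Z m k) μ := by
  unfold despread pilotSignal
  exact HasMoments.sum _ fun i _ => (hasMoments_const _).mul
    (((HasMoments.sum _ fun j _ => ((hasMoments_const _).mul (hg m j)).mul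
      ((hasMoments_const _).add (hZ _))).add (hZ _)).add (hZ _))

theorem hasMoments_dataSignal (hg : ∀ m k, HasMoments (g m k) μ) (hZ : ∀ s, HasMoments (Z s) μ)
    (k : Fin K) (x : Fin T → ℂ) (m : Fin M) (t : Fin T) :
    HasMoments (dataSignal p g Z k x m t) μ := by
  unfold dataSignal
  refine ((HasMoments.sum _ fun j _ => ((hasMoments_const _).mul (hg m j)).mul
      (((hasMoments_const _).mul ?_).add (hZ _))).add (hZ _)).add (hZ _)
  by_cases hj : j = k
  · simp only [hj, if_true]
    exact hasMoments_const _
  · simp only [hj, if_false]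
    exact hZ _

end Signals

section Covariance

variable {p : Params M K τ}

/-- Coefficients of the conditional covariance of the despread pilot signals of APs `m'`, `m`,
as a Hermitian form in the channels. -/
def despreadGain (p : Params M K τ) (k : Fin K) (same : Prop) [Decidable same] (l l' : Fin K) :
    ℂ :=
  (p.κr * (τ * p.ρp * p.κt) : ℝ) * (conj (inner ℂ (p.φ k) (p.φ l)) * inner ℂ (p.φ k) (p.φ l')) +
    if l = l' then ((p.κr * p.ρp * (1 - p.κt) + if same then p.ρp * (1 - p.κr) else 0 : ℝ) : ℂ)
    else 0

/-- Coefficients of the conditional covariance of the data samples of two APs, when UE `k` sends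
a symbol of power `w`. -/
def dataGain (p : Params M K τ) (k : Fin K) (w : ℝ) (same : Prop) [Decidable same] (j : Fin K) :
    ℝ :=
  p.κr * p.ρu * p.γ j * (p.κt * (if j = k then w else 1) + (1 - p.κt)) +
    if same then (1 - p.κr) * p.ρu * p.γ j else 0

theorem sum_conj_mul_self_eq_one (hp : p.Admissible) (k : Fin K) :
    ∑ i, p.φ k i * conj (p.φ k i) = 1 := by
  have h : inner ℂ (p.φ k) (p.φ k) = (1 : ℂ) := by
    rw [inner_self_eq_norm_sq_to_K, hp.φ_unit k]
    simp
  rw [← h, PiLp.inner_apply]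
  simp only [RCLike.inner_apply]

theorem ofReal_sqrt_mul_self {x : ℝ} (hx : 0 ≤ x) : (√x : ℂ) * √x = x := by
  norm_cast
  exact Real.mul_self_sqrt hx

/-- The squared mean gives all pairs (l, l'); transmitter distortion is common to the APs and gives
the diagonal. Receiver distortion also gives a diagonal form, its variance being proportional to ∑
|h|², but like the additive noise it needs m' = m. The unit norm of the pilot removes the sums over
pilot samples. -/
theorem conditional_covariance_despread (hp : p.Admissible) (h : Fin M → Fin K → ℂ)
    (m m' : Fin M) (k : Fin K) :
    ∫ z, conj (affineForm (despreadMean p h m' k) (despreadCoeff p h m' k) z) *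
        affineForm (despreadMean p h m k) (despreadCoeff p h m k) z ∂p.sourceLaw T h =
      (∑ l, ∑ l', conj (h m' l) * h m l' * despreadGain p k (m' = m) l l') +
        if m' = m then (p.σ2 : ℂ) else 0 := by
  unfold Params.sourceLaw
  rw [integral_affineForm_conj_mul (Params.condVar_nonneg hp h), sum_source]
  have hs := sum_conj_mul_self_eq_one hp k
  have hr := ofReal_sqrt_mul_self hp.κr_mem.1.le
  have ht := ofReal_sqrt_mul_self (x := τ * p.ρp * p.κt) (by
    have := hp.κt_mem.1
    have := hp.ρp_pos
    positivity)
  have h1 : conj (despreadMean p h m' k) * despreadMean p h m k =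
      ∑ l, ∑ l', conj (h m' l) * h m l' * ((p.κr * (τ * p.ρp * p.κt) : ℝ) *
        (conj (inner ℂ (p.φ k) (p.φ l)) * inner ℂ (p.φ k) (p.φ l'))) := by
    unfold despreadMean
    rw [map_sum, Finset.sum_mul_sum]
    refine Finset.sum_congr rfl fun l _ => Finset.sum_congr rfl fun l' _ => ?_
    rw [Complex.ofReal_mul, ← hr, ← ht]
    simp only [map_mul, Complex.conj_ofReal]
    ring
  have h2 : ∑ j, ∑ i, conj (despreadCoeff (T := T) p h m' k (.txPilot j i)) *
      despreadCoeff (T := T) p h m k (.txPilot j i) *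
        ((p.condVar h (.txPilot j i : Source M K τ T) : ℝ) : ℂ) =
      ∑ j, conj (h m' j) * h m j * (p.κr * p.ρp * (1 - p.κt)) := by
    refine Finset.sum_congr rfl fun j _ => ?_
    simp only [despreadCoeff, Params.condVar, map_mul, Complex.conj_ofReal, Complex.conj_conj]
    calc _ = (∑ i, p.φ k i * conj (p.φ k i)) *
          (conj (h m' j) * h m j * (((√p.κr : ℂ) * √p.κr) * p.ρp * (1 - p.κt))) := by
          rw [Finset.sum_mul]
          refine Finset.sum_congr rfl fun i _ => ?_
          push_cast
          ring
      _ = _ := by rw [hs, hr, one_mul]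
  have h3 : ∀ v : Fin M → ℂ, ∑ n, ∑ i, conj (if n = m' then conj (p.φ k i) else 0) *
      (if n = m then conj (p.φ k i) else 0) * v n = if m' = m then v m else 0 := by
    intro v
    rw [Finset.sum_eq_single m]
    · by_cases hm : m' = m
      · simp only [hm, if_true, Complex.conj_conj]
        rw [← Finset.sum_mul, hs, one_mul]
      · simp [hm, Ne.symm hm]
    · intro n _ hn
      simp [hn]
    · simp
  have h4 := h3 fun n => ((p.ρp * (1 - p.κr) * ∑ l, ‖h n l‖ ^ 2 : ℝ) : ℂ)
  have h5 := h3 fun _ => (p.σ2 : ℂ)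
  rw [h1, h2]
  simp only [despreadCoeff, Params.condVar, map_zero, zero_mul, Finset.sum_const_zero, add_zero]
  rw [h4, h5, ← add_assoc, ← add_assoc]
  congr 1
  simp only [despreadGain, mul_add, Finset.sum_add_distrib, mul_ite, mul_zero,
    Finset.sum_ite_eq, Finset.mem_univ, if_true]
  rw [add_assoc]
  congr 1
  by_cases hm : m' = m
  · simp only [hm, if_true]
    push_cast
    rw [Finset.mul_sum, ← Finset.sum_add_distrib]
    refine Finset.sum_congr rfl fun l _ => ?_
    rw [← Complex.conj_mul']
    ring
  · simp [hm]

/-- No cross terms between UEs occur: the mean involves UE k alone, and the other symbols and the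
transmitter distortions are independent and centred. -/
theorem conditional_covariance_data (hp : p.Admissible) (h : Fin M → Fin K → ℂ)
    (m m' : Fin M) (k : Fin K) (x : ℂ) (t : Fin T) :
    ∫ z, conj (affineForm (dataMean p h k x m) (dataCoeff p h k m t) z) *
        affineForm (dataMean p h k x m') (dataCoeff p h k m' t) z ∂p.sourceLaw T h =
      (∑ j, conj (h m j) * h m' j * dataGain p k (‖x‖ ^ 2) (m' = m) j) +
        if m' = m then (p.σ2 : ℂ) else 0 := by
  unfold Params.sourceLaw
  rw [integral_affineForm_conj_mul (Params.condVar_nonneg hp h), sum_source]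
  have hr := ofReal_sqrt_mul_self hp.κr_mem.1.le
  have ht : ∀ j, (√(p.ρu * p.γ j * p.κt) : ℂ) * √(p.ρu * p.γ j * p.κt)
      = (p.ρu * p.γ j * p.κt : ℝ) := fun j => ofReal_sqrt_mul_self (by
    have := hp.κt_mem.1
    have := hp.ρu_pos
    have := (hp.γ_mem j).1
    positivity)
  have h1 : conj (dataMean p h k x m) * dataMean p h k x m' =
      ∑ j, conj (h m j) * h m' j * (if j = k then (p.κr * p.ρu * p.γ j * p.κt * ‖x‖ ^ 2 : ℂ)
        else 0) := by
    simp only [mul_ite, mul_zero, Finset.sum_ite_eq', Finset.mem_univ, if_true]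
    have h2 := ht k
    push_cast at h2
    rw [← Complex.conj_mul', ← hr, dataMean, dataMean]
    simp only [map_mul, Complex.conj_ofReal]
    linear_combination (√p.κr * √p.κr * conj x * x * conj (h m k) * h m' k : ℂ) * h2
  have h2 : ∑ j, ∑ t', conj (dataCoeff (T := T) p h k m t (.symbol j t')) *
      dataCoeff (T := T) p h k m' t (.symbol j t') *
        ((p.condVar h (.symbol j t' : Source M K τ T) : ℝ) : ℂ) =
      ∑ j, conj (h m j) * h m' j * (if j = k then 0 else (p.κr * p.ρu * p.γ j * p.κt : ℂ)) := by
    refine Finset.sum_congr rfl fun j _ => ?_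
    rw [Finset.sum_eq_single t (fun t' _ ht' => by simp [dataCoeff, ht']) (by simp)]
    simp only [dataCoeff, Params.condVar, if_true, Complex.ofReal_one, mul_one]
    by_cases hj : j = k
    · simp [hj]
    · have h2 := ht j
      push_cast at h2
      simp only [hj, if_false, map_mul, Complex.conj_ofReal]
      rw [← hr]
      linear_combination (√p.κr * √p.κr * conj (h m j) * h m' j : ℂ) * h2
  have h3 : ∑ j, ∑ t', conj (dataCoeff (T := T) p h k m t (.txData j t')) *
      dataCoeff (T := T) p h k m' t (.txData j t') *
        ((p.condVar h (.txData j t' : Source M K τ T) : ℝ) : ℂ) =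
      ∑ j, conj (h m j) * h m' j * (p.κr * p.ρu * p.γ j * (1 - p.κt)) := by
    refine Finset.sum_congr rfl fun j _ => ?_
    rw [Finset.sum_eq_single t (fun t' _ ht' => by simp [dataCoeff, ht']) (by simp)]
    simp only [dataCoeff, Params.condVar, if_true, map_mul, Complex.conj_ofReal]
    rw [← hr]
    push_cast
    ring
  have h4 : ∀ v : Fin M → ℂ, ∑ n, ∑ t', conj (if n = m ∧ t' = t then (1 : ℂ) else 0) *
      (if n = m' ∧ t' = t then 1 else 0) * v n = if m' = m then v m else 0 := by
    intro v
    rw [Finset.sum_eq_single m (fun n _ hn => by simp [hn]) (by simp),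
      Finset.sum_eq_single t (fun t' _ ht' => by simp [ht']) (by simp)]
    by_cases hm : m' = m
    · simp [hm]
    · simp [hm, Ne.symm hm]
  have h5 := h4 fun n => (((1 - p.κr) * p.ρu * ∑ l, p.γ l * ‖h n l‖ ^ 2 : ℝ) : ℂ)
  have h6 := h4 fun _ => (p.σ2 : ℂ)
  rw [h1, h2, h3]
  simp only [dataCoeff, Params.condVar, map_zero, zero_mul, Finset.sum_const_zero, zero_add]
  rw [h5, h6]
  simp only [← add_assoc]
  congr 1
  have h7 : (if m' = m then (((1 - p.κr) * p.ρu * ∑ l, p.γ l * ‖h m l‖ ^ 2 : ℝ) : ℂ) else 0) =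
      ∑ j, conj (h m j) * h m' j * (if m' = m then ((1 - p.κr) * p.ρu * p.γ j : ℂ) else 0) := by
    by_cases hm : m' = m
    · simp only [hm, if_true]
      push_cast
      rw [Finset.mul_sum]
      refine Finset.sum_congr rfl fun l _ => ?_
      rw [← Complex.conj_mul']
      ring
    · simp [hm]
  rw [h7, ← Finset.sum_add_distrib, ← Finset.sum_add_distrib, ← Finset.sum_add_distrib]
  refine Finset.sum_congr rfl fun j _ => ?_
  by_cases hj : j = k <;> by_cases hm : m' = m <;> simp [dataGain, hj, hm] <;> ring

end Covariance

end

/-! ### Conditional independence of pilot and data phases -/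

section

variable {M K τ T : ℕ} {Ω : Type*}

section Independence

variable {p : Params M K τ}

/-- The sources of the pilot phase. -/
def Source.IsPilot : Source M K τ T → Prop
  | .txPilot _ _ => True
  | .rxPilot _ _ => True
  | .noisePilot _ _ => True
  | _ => False

open Classical in
/-- The sources of the pilot phase, as a finite set. -/
def pilotSources (M K τ T : ℕ) : Finset (Source M K τ T) := Finset.univ.filter Source.IsPilot

theorem dependsOn_despread (h : Fin M → Fin K → ℂ) (m : Fin M) (k : Fin K) :
    DependsOn (affineForm (despreadMean p h m k) (despreadCoeff p h m k))
      (pilotSources M K τ T : Set (Source M K τ T)) := by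
  refine dependsOn_affineForm _ fun s hs => ?_
  cases s <;> simp_all [pilotSources, Source.IsPilot, despreadCoeff]

theorem dependsOn_data (h : Fin M → Fin K → ℂ) (k : Fin K) (x : ℂ) (m : Fin M) (t : Fin T) :
    DependsOn (affineForm (dataMean p h k x m) (dataCoeff p h k m t))
      ((pilotSources M K τ T : Set (Source M K τ T))ᶜ) := by
  refine dependsOn_affineForm _ fun s hs => ?_
  cases s <;> simp_all [pilotSources, Source.IsPilot, dataCoeff]

/-- Given the channels, pilot and data signals involve disjoint sets of sources; the estimates and
the data depend on each other only through the channels. -/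
theorem conditional_product (hp : p.Admissible) (h : Fin M → Fin K → ℂ) (m m' : Fin M)
    (k : Fin K) (x : ℂ) (t : Fin T) :
    ∫ z, (conj (affineForm (despreadMean p h m' k) (despreadCoeff p h m' k) z) *
        affineForm (despreadMean p h m k) (despreadCoeff p h m k) z) *
      (conj (affineForm (dataMean p h k x m) (dataCoeff p h k m t) z) *
        affineForm (dataMean p h k x m') (dataCoeff p h k m' t) z) ∂p.sourceLaw T h =
      ((∑ l, ∑ l', conj (h m' l) * h m l' * despreadGain p k (m' = m) l l') +
        if m' = m then (p.σ2 : ℂ) else 0) *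
      ((∑ j, conj (h m j) * h m' j * dataGain p k (‖x‖ ^ 2) (m' = m) j) +
        if m' = m then (p.σ2 : ℂ) else 0) := by
  rw [← conditional_covariance_despread (T := T) hp, ← conditional_covariance_data hp h m m' k x t]
  refine integral_mul_of_dependsOn (pilotSources M K τ T)
    (F := fun z => conj (affineForm (despreadMean p h m' k) (despreadCoeff p h m' k) z) *
        affineForm (despreadMean p h m k) (despreadCoeff p h m k) z)
    (G := fun z => conj (affineForm (dataMean p h k x m) (dataCoeff p h k m t) z) *
        affineForm (dataMean p h k x m') (dataCoeff p h k m' t) z)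
    (by fun_prop) (by fun_prop) ?_ ?_
  · intro z z' hz
    simp only [dependsOn_despread (p := p) h m k hz, dependsOn_despread (p := p) h m' k hz]
  · intro z z' hz
    simp only [dependsOn_data (p := p) h k x m t hz, dependsOn_data (p := p) h k x m' t hz]

theorem conditional_mean_product (h : Fin M → Fin K → ℂ) (m : Fin M)
    (k : Fin K) (x : ℂ) (t : Fin T) :
    ∫ z, conj (affineForm (despreadMean p h m k) (despreadCoeff p h m k) z) *
      affineForm (dataMean p h k x m) (dataCoeff p h k m t) z ∂p.sourceLaw T h =
      conj (despreadMean p h m k) * dataMean p h k x m := by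
  have h1 : ∫ z, affineForm (despreadMean p h m k) (despreadCoeff p h m k) z ∂p.sourceLaw T h =
      despreadMean p h m k := integral_affineForm _ _
  have h2 : ∫ z, affineForm (dataMean p h k x m) (dataCoeff p h k m t) z ∂p.sourceLaw T h =
      dataMean p h k x m := integral_affineForm _ _
  refine (integral_mul_of_dependsOn (ν := fun s => complexGaussian (p.condVar h s))
    (pilotSources M K τ T)
    (F := fun z => conj (affineForm (despreadMean p h m k) (despreadCoeff p h m k) z))
    (G := affineForm (dataMean p h k x m) (dataCoeff p h k m t))
    (by fun_prop) (by fun_prop) ?_ (dependsOn_data h k x m t)).trans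
    (congrArg₂ (· * ·) (integral_conj.trans (congrArg _ h1)) h2)
  intro z z' hz
  simp only [dependsOn_despread (p := p) h m k hz]

/-- Independent channels leave only the summand j = k, with inner product 1. The value is both the
numerator of the LMMSE coefficient and, up to the symbol amplitude, the correlation of pilot and
data. -/
theorem integral_conj_despreadMean_mul (hp : p.Admissible) (m : Fin M) (k : Fin K) :
    ∫ h, conj (despreadMean p h m k) * h m k ∂p.channelLaw =
      (√(τ * p.ρp * (p.κr * p.κt)) * p.β m k : ℝ) := by
  have hβ : ∀ m k, 0 ≤ p.β m k := fun m k => (hp.β_pos m k).le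
  have e : ∀ h : Fin M → Fin K → ℂ, conj (despreadMean p h m k) * h m k =
      ∑ j, (√p.κr : ℂ) * (√(τ * p.ρp * p.κt) : ℂ) * conj (inner ℂ (p.φ k) (p.φ j)) *
        (conj (h m j) * h m k) := by
    intro h
    rw [despreadMean, map_sum, Finset.sum_mul]
    refine Finset.sum_congr rfl fun j _ => ?_
    simp only [map_mul, Complex.conj_ofReal]
    ring
  simp only [e]
  rw [integral_finsetSum _ fun j _ => ((hasMoments_channelLaw m j).conj.mul
    (hasMoments_channelLaw m k)).integrable.const_mul _]
  simp only [integral_const_mul, integral_channel_covariance hβ, true_and, mul_ite, mul_zero,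
    Finset.sum_ite_eq', Finset.mem_univ, if_true]
  have h1 : inner ℂ (p.φ k) (p.φ k) = (1 : ℂ) := by
    rw [inner_self_eq_norm_sq_to_K, hp.φ_unit k]
    simp
  have h2 : (τ : ℝ) * p.ρp * (p.κr * p.κt) = p.κr * (τ * p.ρp * p.κt) := by ring
  rw [h1, h2, Real.sqrt_mul hp.κr_mem.1.le]
  simp

end Independence

/-! ### Unconditional moments of pilot and data signals -/

section Moments

variable {p : Params M K τ} [MeasurableSpace Ω] {μ : Measure Ω} [IsProbabilityMeasure μ]
  {g : Fin M → Fin K → Ω → ℂ} {Z : Source M K τ T → Ω → ℂ}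

/-- Power of the despread pilot signal. -/
def Params.despreadPower (p : Params M K τ) (m : Fin M) (k : Fin K) : ℝ :=
  p.ρp * ∑ j, p.β m j * (p.κr * p.κt * τ * p.pilotCorr k j + (1 - p.κr * p.κt)) + p.σ2

/-- Diagonal coefficients of the conditional covariance of the despread pilot signals. -/
def Params.pilotGain (p : Params M K τ) (k : Fin K) (same : Prop) [Decidable same] (j : Fin K) :
    ℝ :=
  p.κr * p.ρp * (τ * p.κt * p.pilotCorr k j + (1 - p.κt)) +
    if same then p.ρp * (1 - p.κr) else 0

theorem despreadGain_self (k : Fin K) (same : Prop) [Decidable same] (j : Fin K) :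
    despreadGain p k same j j = p.pilotGain k same j := by
  unfold despreadGain Params.pilotGain Params.pilotCorr
  rw [Complex.conj_mul']
  simp only [if_true]
  push_cast
  ring

theorem sum_pilotGain (p : Params M K τ) (m : Fin M) (k : Fin K) :
    (∑ l, p.pilotGain k True l * p.β m l) + p.σ2 = p.despreadPower m k := by
  unfold Params.pilotGain Params.despreadPower
  rw [Finset.mul_sum]
  congr 1
  refine Finset.sum_congr rfl fun l _ => ?_
  simp only [if_true]
  ring

theorem IsUplinkModel.measurable_despread (hm : IsUplinkModel p μ g Z) (m : Fin M) (k : Fin K) :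
    Measurable (despread p g Z m k) :=
  CellFree.measurable_despread p hm.measurable_channel hm.measurable_source m k

theorem IsUplinkModel.hasMoments_despread (hm : IsUplinkModel p μ g Z) (m : Fin M) (k : Fin K) :
    HasMoments (despread p g Z m k) μ :=
  CellFree.hasMoments_despread p hm.hasMoments_channel hm.hasMoments_source m k

theorem IsUplinkModel.hasMoments_data (hm : IsUplinkModel p μ g Z) (k : Fin K) (x : Fin T → ℂ)
    (m : Fin M) (t : Fin T) : HasMoments (dataSignal p g Z k x m t) μ :=
  hasMoments_dataSignal p hm.hasMoments_channel hm.hasMoments_source k x m t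

theorem measurable_despread_coord (m : Fin M) (k : Fin K) :
    Measurable (fun y : (Fin M → Fin K → ℂ) × (Source M K τ T → ℂ) =>
      affineForm (despreadMean p y.1 m k) (despreadCoeff p y.1 m k) y.2) := by
  have h := measurable_despread (T := T) p
    (g := fun m k (y : (Fin M → Fin K → ℂ) × (Source M K τ T → ℂ)) => y.1 m k)
    (Z := fun s y => y.2 s) (by fun_prop) (by fun_prop) m k
  rwa [funext (despread_eq_affineForm p _ _ m k)] at h

theorem measurable_data_coord (k : Fin K) (x : Fin T → ℂ) (m : Fin M) (t : Fin T) :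
    Measurable (fun y : (Fin M → Fin K → ℂ) × (Source M K τ T → ℂ) =>
      affineForm (dataMean p y.1 k (x t) m) (dataCoeff p y.1 k m t) y.2) := by
  have h := (measurable_dataSignal (T := T) p
    (g := fun m k (y : (Fin M → Fin K → ℂ) × (Source M K τ T → ℂ)) => y.1 m k)
    (Z := fun s y => y.2 s) (by fun_prop) (by fun_prop) k m t).comp
      (measurable_const (a := x) |>.prodMk measurable_id)
  have e : (fun y : (Fin M → Fin K → ℂ) × (Source M K τ T → ℂ) =>
      affineForm (dataMean p y.1 k (x t) m) (dataCoeff p y.1 k m t) y.2) =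
      fun y => dataSignal p (fun m k y => y.1 m k) (fun s y => y.2 s) k x m t y :=
    funext fun y => (dataSignal_eq_affineForm p (fun m k y => y.1 m k) (fun s y => y.2 s)
      k x m t y).symm
  rw [e]
  exact h

theorem IsUplinkModel.integral_despread_channel (hm : IsUplinkModel p μ g Z) (hp : p.Admissible)
    (m : Fin M) (k : Fin K) :
    ∫ ω, conj (despread p g Z m k ω) * g m k ω ∂μ =
      (√(τ * p.ρp * (p.κr * p.κt)) * p.β m k : ℝ) := by
  have hint := ((hm.hasMoments_despread m k).conj.mul (hm.hasMoments_channel m k)).integrable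
  simp only [despread_eq_affineForm] at hint ⊢
  have h1 := measurable_despread_coord (T := T) (p := p) m k
  rw [hm.integral_eq (F := fun y => conj (affineForm (despreadMean p y.1 m k)
    (despreadCoeff p y.1 m k) y.2) * y.1 m k) (by fun_prop) hint,
    ← integral_conj_despreadMean_mul hp]
  refine integral_congr_ae (Filter.Eventually.of_forall fun h => ?_)
  simp only
  rw [integral_mul_const, integral_conj]
  congr 2
  exact integral_affineForm _ _

theorem IsUplinkModel.integral_despread_sq (hm : IsUplinkModel p μ g Z) (hp : p.Admissible)
    (m : Fin M) (k : Fin K) :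
    ∫ ω, conj (despread p g Z m k ω) * despread p g Z m k ω ∂μ = p.despreadPower m k := by
  have hint := ((hm.hasMoments_despread m k).conj.mul (hm.hasMoments_despread m k)).integrable
  simp only [despread_eq_affineForm] at hint ⊢
  have h1 := measurable_despread_coord (T := T) (p := p) m k
  rw [hm.integral_eq (F := fun y => conj (affineForm (despreadMean p y.1 m k)
    (despreadCoeff p y.1 m k) y.2) * affineForm (despreadMean p y.1 m k)
    (despreadCoeff p y.1 m k) y.2) (by fun_prop) hint]
  simp only [conditional_covariance_despread hp]
  -- Taking the second form to be the constant 1 (q = 0, e' = 1) yields the mean of a single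
  -- Hermitian form.
  have h2 := integral_channel_forms (p := p) (fun m k => (hp.β_pos m k).le) m m
    (despreadGain p k (m = m)) (fun _ => 0) p.σ2 1
  simp only [mul_zero, Finset.sum_const_zero, zero_add, if_true, mul_one, zero_mul,
    despreadGain_self] at h2
  simp only [if_true]
  rw [h2, ← sum_pilotGain]
  push_cast
  rfl

theorem IsUplinkModel.integral_despread_data (hm : IsUplinkModel p μ g Z) (hp : p.Admissible)
    (m : Fin M) (k : Fin K) (x : Fin T → ℂ) (t : Fin T) :
    ∫ ω, conj (despread p g Z m k ω) * dataSignal p g Z k x m t ω ∂μ =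
      (√(τ * p.ρp * (p.κr * p.κt)) * p.β m k : ℝ) *
        ((√p.κr : ℂ) * (√(p.ρu * p.γ k * p.κt) : ℂ) * x t) := by
  have hint := ((hm.hasMoments_despread m k).conj.mul (hm.hasMoments_data k x m t)).integrable
  simp only [despread_eq_affineForm, dataSignal_eq_affineForm] at hint ⊢
  have h1 := measurable_despread_coord (T := T) (p := p) m k
  have h2 := measurable_data_coord (p := p) k x m t
  rw [hm.integral_eq (F := fun y => conj (affineForm (despreadMean p y.1 m k)
    (despreadCoeff p y.1 m k) y.2) * affineForm (dataMean p y.1 k (x t) m)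
    (dataCoeff p y.1 k m t) y.2) (by fun_prop) hint,
    ← integral_conj_despreadMean_mul hp, ← integral_mul_const]
  refine integral_congr_ae (Filter.Eventually.of_forall fun h => ?_)
  simp only
  rw [conditional_mean_product, dataMean]
  ring

/-- The sum over j is present for every pair of APs and adds up coherently; the remaining term is
the product of the mean powers at a single AP. -/
theorem IsUplinkModel.integral_products (hm : IsUplinkModel p μ g Z) (hp : p.Admissible)
    (m m' : Fin M) (k : Fin K) (x : Fin T → ℂ) (t : Fin T) :
    ∫ ω, (conj (despread p g Z m' k ω) * despread p g Z m k ω) *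
      (conj (dataSignal p g Z k x m t ω) * dataSignal p g Z k x m' t ω) ∂μ =
      ((∑ j, p.pilotGain k (m' = m) j * dataGain p k (‖x t‖ ^ 2) (m' = m) j *
          (p.β m' j * p.β m j) +
        if m' = m then p.despreadPower m k *
          ((∑ j, dataGain p k (‖x t‖ ^ 2) True j * p.β m j) + p.σ2) else 0 : ℝ) : ℂ) := by
  have hint := (((hm.hasMoments_despread m' k).conj.mul (hm.hasMoments_despread m k)).mul
    ((hm.hasMoments_data k x m t).conj.mul (hm.hasMoments_data k x m' t))).integrable
  simp only [despread_eq_affineForm, dataSignal_eq_affineForm] at hint ⊢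
  have h1 := measurable_despread_coord (T := T) (p := p) m k
  have h1' := measurable_despread_coord (T := T) (p := p) m' k
  have h2 := measurable_data_coord (p := p) k x m t
  have h2' := measurable_data_coord (p := p) k x m' t
  rw [hm.integral_eq (F := fun y => (conj (affineForm (despreadMean p y.1 m' k)
    (despreadCoeff p y.1 m' k) y.2) * affineForm (despreadMean p y.1 m k)
    (despreadCoeff p y.1 m k) y.2) * (conj (affineForm (dataMean p y.1 k (x t) m)
    (dataCoeff p y.1 k m t) y.2) * affineForm (dataMean p y.1 k (x t) m')
    (dataCoeff p y.1 k m' t) y.2)) (by fun_prop) hint]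
  simp only [conditional_product hp]
  rw [integral_channel_forms (p := p) (fun m k => (hp.β_pos m k).le)]
  simp only [despreadGain_self, ← sum_pilotGain]
  by_cases hmm : m' = m
  · simp [hmm]
  · simp [hmm]

end Moments

end

/-! ### Closed form of the power and positivity of the denominator -/

section

variable {M K τ T : ℕ} {Ω : Type*}

section ClosedForm

variable (p : Params M K τ)

/-- Power of the combined signal of UE `k` when it sends a symbol of power `w`. -/
def Params.combinedPower (k : Fin K) (w : ℝ) : ℝ :=
  ∑ m, ∑ m', p.c m k * p.c m' k *
    (∑ j, p.pilotGain k (m' = m) j * dataGain p k w (m' = m) j * (p.β m' j * p.β m j) +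
      if m' = m then p.despreadPower m k * ((∑ j, dataGain p k w True j * p.β m j) + p.σ2) else 0)

/-- Amplitude of the symbol of UE `k` in the mean of its combined signal. -/
def Params.combinedGain (k : Fin K) : ℝ := √p.κr * √(p.ρu * p.γ k * p.κt) * ∑ m, p.lam m k

/-- Because the power is affine in w, averaging over inputs with E|x|² = 1 gives its value at w = 1,
whatever the slope b. -/
theorem Params.combinedPower_affine (k : Fin K) :
    ∃ b, ∀ w, p.combinedPower k w = p.combinedPower k 1 + b * (w - 1) := by
  let d : Fin K → ℝ := fun j => if j = k then p.κr * p.ρu * p.γ j * p.κt else 0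
  have hd : ∀ w (same : Prop) [Decidable same] (j : Fin K),
      dataGain p k w same j = dataGain p k 1 same j + d j * (w - 1) := by
    intro w same _ j
    unfold dataGain
    by_cases hj : j = k
    · simp only [hj, d, if_true]
      ring
    · simp [hj, d]
  refine ⟨∑ m, ∑ m', p.c m k * p.c m' k *
    (∑ j, p.pilotGain k (m' = m) j * d j * (p.β m' j * p.β m j) +
      if m' = m then p.despreadPower m k * (∑ j, d j * p.β m j) else 0), fun w => ?_⟩
  unfold Params.combinedPower
  rw [Finset.sum_mul, ← Finset.sum_add_distrib]
  refine Finset.sum_congr rfl fun m _ => ?_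
  rw [Finset.sum_mul, ← Finset.sum_add_distrib]
  refine Finset.sum_congr rfl fun m' _ => ?_
  simp only [hd w, mul_add, add_mul, Finset.sum_add_distrib, ← mul_assoc]
  have e1 : ∑ j, p.pilotGain k (m' = m) j * d j * (w - 1) * p.β m' j * p.β m j =
      (∑ j, p.pilotGain k (m' = m) j * d j * p.β m' j * p.β m j) * (w - 1) := by
    rw [Finset.sum_mul]
    exact Finset.sum_congr rfl fun j _ => by ring
  have e2 : ∑ j, d j * (w - 1) * p.β m j = (∑ j, d j * p.β m j) * (w - 1) := by
    rw [Finset.sum_mul]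
    exact Finset.sum_congr rfl fun j _ => by ring
  rw [e1, e2]
  split_ifs <;> ring

variable {p}

theorem Params.Admissible.despreadPower_pos (hp : p.Admissible) (m : Fin M) (k : Fin K) :
    0 < p.despreadPower m k := by
  have h1 := hp.κt_mem
  have h2 := hp.κr_mem
  have h3 := hp.ρp_pos
  have h4 := hp.σ2_pos
  have h5 : p.κr * p.κt ≤ 1 := mul_le_one₀ h2.2 h1.1.le h1.2
  unfold Params.despreadPower
  have : 0 ≤ ∑ j, p.β m j * (p.κr * p.κt * τ * p.pilotCorr k j + (1 - p.κr * p.κt)) := by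
    refine Finset.sum_nonneg fun j _ => mul_nonneg (hp.β_pos m j).le ?_
    have h6 : 0 ≤ p.pilotCorr k j := sq_nonneg _
    have h7 : 0 ≤ 1 - p.κr * p.κt := by linarith
    have := h1.1
    have := h2.1
    positivity
  positivity

/-- A space of dimension 0 has no unit vector, so the existence of a UE forces τ > 0. -/
theorem Params.Admissible.length_pos (hp : p.Admissible) (k : Fin K) : 0 < τ := by
  rcases Nat.eq_zero_or_pos τ with rfl | h
  · have := hp.φ_unit k
    rw [Subsingleton.elim (p.φ k) 0, norm_zero] at this
    exact absurd this zero_ne_one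
  · exact h

theorem Params.Admissible.c_mul_despreadPower (hp : p.Admissible) (m : Fin M) (k : Fin K) :
    p.c m k * p.despreadPower m k = √(τ * p.ρp * (p.κr * p.κt)) * p.β m k :=
  div_mul_cancel₀ _ (hp.despreadPower_pos m k).ne'

theorem Params.Admissible.lam_eq (hp : p.Admissible) (m : Fin M) (k : Fin K) :
    p.lam m k = p.c m k ^ 2 * p.despreadPower m k := by
  rw [pow_two, mul_assoc, hp.c_mul_despreadPower, Params.lam, mul_comm]

theorem Params.Admissible.c_pos (hp : p.Admissible) (m : Fin M) (k : Fin K) : 0 < p.c m k := by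
  have h1 := hp.κt_mem.1
  have h2 := hp.κr_mem.1
  have h3 := hp.ρp_pos
  have h4 := hp.length_pos k
  have h5 := hp.β_pos m k
  exact div_pos (by positivity) (hp.despreadPower_pos m k)

theorem Params.Admissible.lam_pos (hp : p.Admissible) (m : Fin M) (k : Fin K) :
    0 < p.lam m k := by
  rw [hp.lam_eq]
  have := hp.c_pos m k
  have := hp.despreadPower_pos m k
  positivity

theorem Params.Admissible.combinedGain_sq (hp : p.Admissible) (k : Fin K) :
    p.combinedGain k ^ 2 = p.ρu * (p.κr * p.κt * p.termA k) := by
  have h1 := hp.κt_mem.1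
  have h2 := hp.κr_mem.1
  have h3 := hp.ρu_pos
  have h4 := (hp.γ_mem k).1
  unfold Params.combinedGain Params.termA
  rw [mul_pow, mul_pow, Real.sq_sqrt h2.le, Real.sq_sqrt (by positivity)]
  ring

theorem Params.Admissible.combinedPower_one (hp : p.Admissible) (k : Fin K) :
    p.combinedPower k 1 = p.ρu * (p.κr * p.termB k + p.κr * p.termC k
      + (1 - p.κr) * p.termD k + p.termE k) := by
  have hκt := hp.κt_mem.1
  have hκr := hp.κr_mem.1
  have hρp := hp.ρp_pos
  have hρu := hp.ρu_pos
  have hτ : (0 : ℝ) < τ := by exact_mod_cast hp.length_pos k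
  -- The part of the pilot gain that is present for every pair of APs.
  let s0 : Fin K → ℝ := fun j => p.κr * p.ρp * (τ * p.κt * p.pilotCorr k j + (1 - p.κt))
  have hC : p.ρu * (p.κr * p.termC k) =
      ∑ j, s0 j * (p.κr * p.ρu * p.γ j) * (∑ m, p.c m k * p.β m j) ^ 2 := by
    unfold Params.termC
    rw [Finset.mul_sum, Finset.mul_sum]
    refine Finset.sum_congr rfl fun j _ => ?_
    have h1 : ∑ m, p.lam m k * (p.β m j / p.β m k) =
        √(τ * p.ρp * (p.κr * p.κt)) * ∑ m, p.c m k * p.β m j := by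
      rw [Finset.mul_sum]
      refine Finset.sum_congr rfl fun m _ => ?_
      have := (hp.β_pos m k).ne'
      unfold Params.lam
      field_simp
    rw [h1, mul_pow, Real.sq_sqrt (by positivity)]
    simp only [s0]
    field_simp
  have hB : p.termB k = ∑ m, ∑ j, p.γ j * (p.lam m k * p.β m j +
      p.ρp * (1 - p.κr) * (p.c m k ^ 2 * p.β m j ^ 2)) := by
    unfold Params.termB
    rw [Finset.sum_comm]
    refine Finset.sum_congr rfl fun j _ => ?_
    rw [← Finset.mul_sum, Finset.sum_add_distrib, ← Finset.mul_sum]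
  -- The products of cross-AP gains stay in the double sum, which factors into the squares of C
  -- (`hfirst`). Every product with a receiver-distortion factor, and the product of mean powers,
  -- lives on m' = m.
  have hsplit : p.combinedPower k 1 =
      (∑ m, ∑ m', p.c m k * p.c m' k *
        ∑ j, s0 j * (p.κr * p.ρu * p.γ j) * (p.β m' j * p.β m j)) +
      ∑ m, p.c m k ^ 2 * ((∑ j, (p.ρp * (1 - p.κr) * (p.κr * p.ρu * p.γ j) +
        s0 j * ((1 - p.κr) * p.ρu * p.γ j) +
        p.ρp * (1 - p.κr) * ((1 - p.κr) * p.ρu * p.γ j)) * p.β m j ^ 2) +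
        p.despreadPower m k * ((∑ j, p.ρu * p.γ j * p.β m j) + p.σ2)) := by
    unfold Params.combinedPower
    rw [← Finset.sum_add_distrib]
    refine Finset.sum_congr rfl fun m _ => ?_
    -- Writing the diagonal term as an indicator sum over m' allows a comparison summand by summand.
    have h2 : ∀ F : ℝ, F = ∑ m', if m' = m then F else 0 := fun F => by simp
    rw [h2 (p.c m k ^ 2 * _), ← Finset.sum_add_distrib]
    refine Finset.sum_congr rfl fun m' _ => ?_
    by_cases hm : m' = m
    · subst hm
      simp only [if_true, dataGain, Params.pilotGain, ite_self, s0]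
      have h3 : ∀ j, p.κr * p.ρu * p.γ j * (p.κt * 1 + (1 - p.κt)) + (1 - p.κr) * p.ρu * p.γ j
          = p.ρu * p.γ j := fun j => by ring
      simp only [h3]
      rw [← pow_two, ← mul_add, ← add_assoc, ← Finset.sum_add_distrib]
      congr 2
      refine Finset.sum_congr rfl fun j _ => ?_
      ring
    · simp only [hm, if_false, add_zero, dataGain, Params.pilotGain, ite_self, s0]
      congr 1
      refine Finset.sum_congr rfl fun j _ => ?_
      ring
  have hfirst : (∑ m, ∑ m', p.c m k * p.c m' k *
        ∑ j, s0 j * (p.κr * p.ρu * p.γ j) * (p.β m' j * p.β m j)) =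
      ∑ j, s0 j * (p.κr * p.ρu * p.γ j) * (∑ m, p.c m k * p.β m j) ^ 2 := by
    have e1 : ∀ m, ∑ m', p.c m k * p.c m' k *
        ∑ j, s0 j * (p.κr * p.ρu * p.γ j) * (p.β m' j * p.β m j) =
        ∑ j, ∑ m', s0 j * (p.κr * p.ρu * p.γ j) *
          ((p.c m k * p.β m j) * (p.c m' k * p.β m' j)) := by
      intro m
      rw [Finset.sum_comm]
      refine Finset.sum_congr rfl fun m' _ => ?_
      rw [Finset.mul_sum]
      exact Finset.sum_congr rfl fun j _ => by ring
    simp only [e1]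
    rw [Finset.sum_comm]
    refine Finset.sum_congr rfl fun j _ => ?_
    rw [pow_two, Finset.sum_mul_sum]
    simp only [Finset.mul_sum]
  rw [hsplit, hfirst, ← hC, hB, Params.termD, Params.termE]
  -- Per AP, pilot receiver distortion times the transmitted part of the data goes to κr B, and all
  -- products with the data receiver distortion go to (1-κr) D. The mean-power product, with c² ·
  -- `despreadPower` = λ, splits as κr + (1-κr) between B and D, its noise part giving E.
  have hm : ∀ m, p.c m k ^ 2 * ((∑ j, (p.ρp * (1 - p.κr) * (p.κr * p.ρu * p.γ j) +
        s0 j * ((1 - p.κr) * p.ρu * p.γ j) +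
        p.ρp * (1 - p.κr) * ((1 - p.κr) * p.ρu * p.γ j)) * p.β m j ^ 2) +
        p.despreadPower m k * ((∑ j, p.ρu * p.γ j * p.β m j) + p.σ2)) =
      p.ρu * (p.κr * ∑ j, p.γ j * (p.lam m k * p.β m j +
        p.ρp * (1 - p.κr) * (p.c m k ^ 2 * p.β m j ^ 2)) +
      (1 - p.κr) * ∑ j, p.γ j * (p.lam m k * p.β m j
        + p.c m k ^ 2 * (1 - p.κr) * p.ρp * p.β m j ^ 2
        + p.c m k ^ 2 * p.κr * p.ρp * p.β m j ^ 2 * (τ * p.κt * p.pilotCorr k j + (1 - p.κt))) +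
      p.σ2 / p.ρu * p.lam m k) := by
    intro m
    have h4 : p.c m k ^ 2 * (p.despreadPower m k * ((∑ j, p.ρu * p.γ j * p.β m j) + p.σ2)) =
        (∑ j, p.ρu * p.γ j * (p.lam m k * p.β m j)) + p.lam m k * p.σ2 := by
      rw [← mul_assoc, ← hp.lam_eq, mul_add, Finset.mul_sum]
      congr 1
      exact Finset.sum_congr rfl fun j _ => by ring
    have h5 : p.ρu * (p.σ2 / p.ρu * p.lam m k) = p.lam m k * p.σ2 := by
      field_simp
    rw [mul_add (p.c m k ^ 2), h4, mul_add p.ρu, h5, ← add_assoc]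
    congr 1
    simp only [Finset.mul_sum, ← Finset.sum_add_distrib]
    refine Finset.sum_congr rfl fun j _ => ?_
    simp only [s0]
    ring
  simp only [hm, ← Finset.mul_sum, Finset.sum_add_distrib]
  ring

/-- The summand j = k of C is at least A, since the pilot has unit norm, so κr C absorbs κr κt A.
Strictness comes from the noise term E, positive because there is at least one AP. -/
theorem Params.Admissible.interference_pos (hM : 0 < M) (hp : p.Admissible) (k : Fin K) :
    0 < p.κr * p.termB k + p.κr * p.termC k - p.κr * p.κt * p.termA k
      + (1 - p.κr) * p.termD k + p.termE k := by
  have hκt := hp.κt_mem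
  have hκr := hp.κr_mem
  have hρp := hp.ρp_pos
  have hρu := hp.ρu_pos
  have hσ := hp.σ2_pos
  have hτ : (0 : ℝ) < τ := by exact_mod_cast hp.length_pos k
  have hγ := fun j => (hp.γ_mem j).1
  have hc := fun m => hp.c_pos m k
  have hl := fun m => hp.lam_pos m k
  have hβ := hp.β_pos
  have h1 : 0 ≤ 1 - p.κt := by linarith
  have h2 : 0 ≤ 1 - p.κr := by linarith
  have hκt0 := hκt.1
  have hκr0 := hκr.1
  have hpc : ∀ j, 0 ≤ p.pilotCorr k j := fun j => sq_nonneg _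
  have hB : 0 ≤ p.termB k := by
    refine Finset.sum_nonneg fun j _ => mul_nonneg (hγ j) (add_nonneg ?_ ?_)
    · exact Finset.sum_nonneg fun m _ => (mul_pos (hl m) (hβ m j)).le
    · exact mul_nonneg (by positivity) (Finset.sum_nonneg fun m _ => by positivity)
  have hD : 0 ≤ p.termD k := by
    refine Finset.sum_nonneg fun m _ => Finset.sum_nonneg fun j _ => mul_nonneg (hγ j) ?_
    have := hl m
    have := hβ m j
    have := hpc j
    positivity
  have hE : 0 < p.termE k := by
    have : Nonempty (Fin M) := ⟨⟨0, hM⟩⟩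
    exact mul_pos (by positivity) (Finset.sum_pos (fun m _ => hl m) Finset.univ_nonempty)
  have hC : p.termA k ≤ p.termC k := by
    have hnn : ∀ j ∈ Finset.univ, 0 ≤ p.γ j * (p.pilotCorr k j + (1 - p.κt) / (p.κt * τ)) *
        (∑ m, p.lam m k * (p.β m j / p.β m k)) ^ 2 := by
      intro j _
      have := hγ j
      have := hpc j
      positivity
    refine le_trans ?_ (Finset.single_le_sum hnn (Finset.mem_univ k))
    have h3 : p.pilotCorr k k = 1 := by
      unfold Params.pilotCorr
      rw [inner_self_eq_norm_sq_to_K, hp.φ_unit k]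
      simp
    have h4 : ∀ m, p.lam m k * (p.β m k / p.β m k) = p.lam m k := fun m => by
      rw [div_self (hβ m k).ne', mul_one]
    simp only [h3, h4]
    unfold Params.termA
    have h5 : 0 ≤ (1 - p.κt) / (p.κt * τ) := by positivity
    have h6 := mul_nonneg (hγ k) h5
    nlinarith [mul_nonneg h6 (sq_nonneg (∑ m, p.lam m k))]
  have hA : 0 ≤ p.termA k := mul_nonneg (hγ k) (sq_nonneg _)
  have h7 : p.κt * p.termA k ≤ p.termC k := (mul_le_of_le_one_left hA hκt.2).trans hC
  have h8 := mul_le_mul_of_nonneg_left h7 hκr0.le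
  have h9 := mul_nonneg hκr0.le hB
  have h10 := mul_nonneg h2 hD
  linarith

end ClosedForm

end

/-! ### Moments of the combined signal and the capacity bound -/

section

variable {M K τ T : ℕ} {Ω : Type*} [MeasurableSpace Ω]

section Capacity

variable {p : Params M K τ} {μ : Measure Ω} [IsProbabilityMeasure μ]
  {g : Fin M → Fin K → Ω → ℂ} {Z : Source M K τ T → Ω → ℂ}

theorem IsUplinkModel.integral_norm_sq_despread (hm : IsUplinkModel p μ g Z)
    (hp : p.Admissible) (m : Fin M) (k : Fin K) :
    ∫ ω, ‖despread p g Z m k ω‖ ^ 2 ∂μ = p.despreadPower m k := by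
  have h := hm.integral_despread_sq hp m k
  rw [← ofReal_integral_norm_sq] at h
  exact_mod_cast h

theorem IsUplinkModel.lmmseCoeff_eq (hm : IsUplinkModel p μ g Z) (hp : p.Admissible)
    (m : Fin M) (k : Fin K) : lmmseCoeff μ (despread p g Z m k) (g m k) = (p.c m k : ℂ) := by
  unfold lmmseCoeff
  rw [hm.integral_despread_channel hp, hm.integral_norm_sq_despread hp, ← Complex.ofReal_div]
  -- The denominator in `c` is `despreadPower` by definition.
  rfl

theorem IsUplinkModel.integral_norm_sq_channelEstimate (hm : IsUplinkModel p μ g Z)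
    (hp : p.Admissible) (m : Fin M) (k : Fin K) :
    ∫ ω, ‖channelEstimate p μ g Z m k ω‖ ^ 2 ∂μ = p.lam m k := by
  unfold channelEstimate
  rw [hm.lmmseCoeff_eq hp]
  simp only [norm_mul, mul_pow, Complex.norm_real, Real.norm_eq_abs, sq_abs]
  rw [integral_const_mul, hm.integral_norm_sq_despread hp, hp.lam_eq]

theorem IsUplinkModel.combinedSignal_eq (hm : IsUplinkModel p μ g Z) (hp : p.Admissible)
    (k : Fin K) (x : Fin T → ℂ) (ω : Ω) (t : Fin T) :
    combinedSignal p μ g Z k x ω t =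
      ∑ m, (p.c m k : ℂ) * (conj (despread p g Z m k ω) * dataSignal p g Z k x m t ω) := by
  unfold combinedSignal channelEstimate
  refine Finset.sum_congr rfl fun m _ => ?_
  rw [hm.lmmseCoeff_eq hp, map_mul, Complex.conj_ofReal, mul_assoc]

theorem IsUplinkModel.measurable_combinedSignal (hm : IsUplinkModel p μ g Z) (k : Fin K) :
    Measurable (fun z : (Fin T → ℂ) × Ω => combinedSignal p μ g Z k z.1 z.2) := by
  have h1 := hm.measurable_despread
  have h2 := measurable_dataSignal p hm.measurable_channel hm.measurable_source k
  unfold combinedSignal channelEstimate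
  refine measurable_pi_lambda _ fun t => Finset.measurable_sum _ fun m _ => ?_
  have h3 := h2 m t
  have h4 := h1 m k
  fun_prop

theorem IsUplinkModel.hasMoments_combinedSignal (hm : IsUplinkModel p μ g Z) (hp : p.Admissible)
    (k : Fin K) (x : Fin T → ℂ) (t : Fin T) :
    HasMoments (fun ω => combinedSignal p μ g Z k x ω t) μ := by
  simp only [hm.combinedSignal_eq hp]
  exact HasMoments.sum _ fun m _ => (hasMoments_const _).mul
    ((hm.hasMoments_despread m k).conj.mul (hm.hasMoments_data k x m t))

theorem IsUplinkModel.integral_combinedSignal (hm : IsUplinkModel p μ g Z) (hp : p.Admissible)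
    (k : Fin K) (x : Fin T → ℂ) (t : Fin T) :
    ∫ ω, combinedSignal p μ g Z k x ω t ∂μ = p.combinedGain k * x t := by
  simp only [hm.combinedSignal_eq hp]
  rw [integral_finsetSum _ fun m _ => ((hm.hasMoments_despread m k).conj.mul
    (hm.hasMoments_data k x m t)).integrable.const_mul _]
  simp only [integral_const_mul, hm.integral_despread_data hp, Params.combinedGain, Params.lam]
  push_cast
  rw [Finset.mul_sum, Finset.sum_mul]
  refine Finset.sum_congr rfl fun m _ => ?_
  ring

theorem IsUplinkModel.integral_combinedSignal_sq (hm : IsUplinkModel p μ g Z) (hp : p.Admissible)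
    (k : Fin K) (x : Fin T → ℂ) (t : Fin T) :
    ∫ ω, conj (combinedSignal p μ g Z k x ω t) * combinedSignal p μ g Z k x ω t ∂μ =
      p.combinedPower k (‖x t‖ ^ 2) := by
  have e : ∀ ω, conj (combinedSignal p μ g Z k x ω t) * combinedSignal p μ g Z k x ω t =
      ∑ m, ∑ m', (p.c m k : ℂ) * p.c m' k *
        ((conj (despread p g Z m' k ω) * despread p g Z m k ω) *
          (conj (dataSignal p g Z k x m t ω) * dataSignal p g Z k x m' t ω)) := by
    intro ω
    rw [hm.combinedSignal_eq hp, map_sum, Finset.sum_mul_sum]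
    refine Finset.sum_congr rfl fun m _ => Finset.sum_congr rfl fun m' _ => ?_
    simp only [map_mul, Complex.conj_ofReal, Complex.conj_conj]
    ring
  have hi : ∀ m m', Integrable (fun ω => (p.c m k : ℂ) * p.c m' k *
        ((conj (despread p g Z m' k ω) * despread p g Z m k ω) *
          (conj (dataSignal p g Z k x m t ω) * dataSignal p g Z k x m' t ω))) μ := fun m m' =>
    (((hm.hasMoments_despread m' k).conj.mul (hm.hasMoments_despread m k)).mul
      ((hm.hasMoments_data k x m t).conj.mul (hm.hasMoments_data k x m' t))).integrable.const_mul _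
  simp only [e]
  rw [integral_finsetSum _ fun m _ => integrable_finsetSum _ fun m' _ => hi m m',
    Params.combinedPower, Complex.ofReal_sum]
  refine Finset.sum_congr rfl fun m _ => ?_
  rw [integral_finsetSum _ fun m' _ => hi m m', Complex.ofReal_sum]
  refine Finset.sum_congr rfl fun m' _ => ?_
  rw [integral_const_mul, hm.integral_products hp, ← Complex.ofReal_mul, ← Complex.ofReal_mul]

/-- Mean squared error of a linear estimate of a given symbol from the combined signal. -/
theorem IsUplinkModel.integral_error (hm : IsUplinkModel p μ g Z) (hp : p.Admissible)
    (k : Fin K) (x : Fin T → ℂ) (t : Fin T) (a : ℝ) :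
    ∫ ω, ‖x t - a * combinedSignal p μ g Z k x ω t‖ ^ 2 ∂μ =
      ‖x t‖ ^ 2 * (1 - 2 * a * p.combinedGain k) + a ^ 2 * p.combinedPower k (‖x t‖ ^ 2) := by
  have hr := hm.hasMoments_combinedSignal hp k x t
  have e : ∀ ω, conj (x t - a * combinedSignal p μ g Z k x ω t) *
      (x t - a * combinedSignal p μ g Z k x ω t) =
      (conj (x t) * x t + -(a * conj (x t)) * combinedSignal p μ g Z k x ω t) +
      (-(a * x t) * conj (combinedSignal p μ g Z k x ω t) +
        a ^ 2 * (conj (combinedSignal p μ g Z k x ω t) * combinedSignal p μ g Z k x ω t)) := by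
    intro ω
    simp only [map_sub, map_mul, Complex.conj_ofReal]
    ring
  have i1 := hr.integrable.const_mul (-(a * conj (x t)))
  have i2 := hr.conj.integrable.const_mul (-(a * x t))
  have i3 := (hr.conj.mul hr).integrable.const_mul ((a : ℂ) ^ 2)
  have i0 : Integrable (fun _ : Ω => conj (x t) * x t) μ := integrable_const _
  have h : ((∫ ω, ‖x t - a * combinedSignal p μ g Z k x ω t‖ ^ 2 ∂μ : ℝ) : ℂ) =
      ((‖x t‖ ^ 2 * (1 - 2 * a * p.combinedGain k) +
        a ^ 2 * p.combinedPower k (‖x t‖ ^ 2) : ℝ) : ℂ) := by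
    rw [ofReal_integral_norm_sq]
    simp only [e]
    rw [integral_add (by exact i0.add i1) (by exact i2.add i3), integral_add i0 i1,
      integral_add i2 i3, integral_const_mul (-(a * conj (x t))),
      integral_const_mul (-(a * x t)), integral_const_mul ((a : ℂ) ^ 2),
      integral_conj, hm.integral_combinedSignal hp, hm.integral_combinedSignal_sq hp]
    simp only [integral_const, probReal_univ, one_smul, map_mul, Complex.conj_ofReal]
    push_cast
    rw [← Complex.conj_mul']
    ring
  exact_mod_cast h

theorem IsUplinkModel.integrable_error (hm : IsUplinkModel p μ g Z) (hp : p.Admissible)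
    (k : Fin K) (t : Fin T) (a : ℝ) :
    Integrable (fun z : (Fin T → ℂ) × Ω => ‖z.1 t - a * combinedSignal p μ g Z k z.1 z.2 t‖ ^ 2)
      ((Measure.pi fun _ : Fin T => complexGaussian 1).prod μ) := by
  have hc := hm.measurable_combinedSignal k
  obtain ⟨b, hb⟩ := p.combinedPower_affine k
  obtain ⟨hx, -⟩ := integral_norm_sq_input t
  -- The inner integral over ω is affine in |x_t|², so only the second moment of the input is
  -- needed.
  rw [integrable_prod_iff (Measurable.aestronglyMeasurable (by fun_prop))]
  constructor
  · refine Filter.Eventually.of_forall fun x => ?_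
    have h2 : MemLp (fun ω => x t - a * combinedSignal p μ g Z k x ω t) 2 μ :=
      (memLp_const (x t)).sub ((hm.hasMoments_combinedSignal hp k x t 2).const_mul (a : ℂ))
    exact h2.integrable_norm_pow (by norm_num)
  · have e : ∀ x : Fin T → ℂ, ∫ ω, ‖x t - a * combinedSignal p μ g Z k x ω t‖ ^ 2 ∂μ =
        ‖x t‖ ^ 2 * (1 - 2 * a * p.combinedGain k) +
          a ^ 2 * (p.combinedPower k 1 + b * (‖x t‖ ^ 2 - 1)) :=
      fun x => by rw [hm.integral_error hp, hb]
    simp only [norm_pow, norm_norm, e]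
    exact (hx.mul_const _).add (((integrable_const _).add
      ((hx.sub (integrable_const _)).const_mul b)).const_mul _)

theorem IsUplinkModel.integral_prod_error (hm : IsUplinkModel p μ g Z) (hp : p.Admissible)
    (k : Fin K) (t : Fin T) (a : ℝ) :
    ∫ z : (Fin T → ℂ) × Ω, ‖z.1 t - a * combinedSignal p μ g Z k z.1 z.2 t‖ ^ 2
      ∂((Measure.pi fun _ : Fin T => complexGaussian 1).prod μ) =
      1 - 2 * a * p.combinedGain k + a ^ 2 * p.combinedPower k 1 := by
  obtain ⟨b, hb⟩ := p.combinedPower_affine k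
  obtain ⟨hx, hx1⟩ := integral_norm_sq_input t
  rw [integral_prod _ (hm.integrable_error hp k t a)]
  have e : ∀ x : Fin T → ℂ, ∫ ω, ‖x t - a * combinedSignal p μ g Z k x ω t‖ ^ 2 ∂μ =
      ‖x t‖ ^ 2 * (1 - 2 * a * p.combinedGain k + a ^ 2 * b) +
        a ^ 2 * (p.combinedPower k 1 - b) := fun x => by
    rw [hm.integral_error hp, hb]
    ring
  simp only [e]
  rw [integral_add (hx.mul_const _) (integrable_const _), integral_mul_const, hx1, integral_const]
  simp
  ring

theorem IsUplinkModel.rate_le_uplinkCapacity (hM : 0 < M) (hT : 0 < T)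
    (hm : IsUplinkModel p μ g Z) (hp : p.Admissible) (k : Fin K) :
    ENNReal.ofReal (p.rate k) ≤ uplinkCapacity p μ g Z k := by
  have hρu := hp.ρu_pos
  have hN := hp.interference_pos hM k
  set N := p.κr * p.termB k + p.κr * p.termC k - p.κr * p.κt * p.termA k
      + (1 - p.κr) * p.termD k + p.termE k with hNdef
  set A := p.κr * p.κt * p.termA k with hA
  have hA0 : 0 ≤ A := by
    have h1 := hp.κt_mem.1.le
    have h2 := hp.κr_mem.1.le
    have h3 : 0 ≤ p.termA k := mul_nonneg (hp.γ_mem k).1 (sq_nonneg _)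
    positivity
  have hS : p.combinedPower k 1 = p.ρu * (N + A) := by
    rw [hp.combinedPower_one]
    ring
  have hG : p.combinedGain k ^ 2 = p.ρu * A := hp.combinedGain_sq k
  have hv : 0 < N / (N + A) := by positivity
  -- The minimizer of 1 - 2 a G + a² S; the minimum 1 - G²/S equals N/(N+A).
  set a : ℝ := p.combinedGain k / p.combinedPower k 1 with ha
  have herr : ∀ t : Fin T, ∫ z : (Fin T → ℂ) × Ω,
      ‖z.1 t - a * combinedSignal p μ g Z k z.1 z.2 t‖ ^ 2
      ∂((Measure.pi fun _ : Fin T => complexGaussian 1).prod μ) = N / (N + A) := by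
    intro t
    rw [hm.integral_prod_error hp]
    have hS0 : p.combinedPower k 1 ≠ 0 := by rw [hS]; positivity
    have h1 : 1 - 2 * a * p.combinedGain k + a ^ 2 * p.combinedPower k 1 =
        1 - p.combinedGain k ^ 2 / p.combinedPower k 1 := by
      rw [ha]
      field_simp
      ring
    rw [h1, hG, hS]
    field_simp
    ring
  have hmain := ofReal_mul_log_le_mutualInfo μ (hm.measurable_combinedSignal k) hv (a : ℂ)
    (fun t => hm.integrable_error hp k t a) herr
  -- The factor T cancels, which requires T > 0, and 1 + A/N is the inverse of the error power.
  have hrate : p.rate k = T * -Real.log (N / (N + A)) / (T * Real.log 2) := by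
    have hT' : (T : ℝ) ≠ 0 := by positivity
    have h1 : 1 + A / N = (N / (N + A))⁻¹ := by
      field_simp
    rw [mul_div_mul_left _ _ hT', ← Real.log_inv, ← h1]
    rfl
  have hlog : 0 < (T : ℝ) * Real.log 2 := mul_pos (by positivity) (Real.log_pos one_lt_two)
  -- The Gaussian input meets the power constraint with equality.
  have hpow : ∫⁻ x, ∑ t, ‖x t‖ₑ ^ 2 ∂(Measure.pi fun _ : Fin T => complexGaussian 1)
      ≤ (T : ℝ≥0∞) := by
    rw [lintegral_finsetSum _ fun t _ => by fun_prop]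
    have h1 : ∀ t : Fin T, ∫⁻ x, ‖x t‖ₑ ^ 2 ∂(Measure.pi fun _ : Fin T => complexGaussian 1)
        = 1 := by
      intro t
      obtain ⟨hx, hx1⟩ := integral_norm_sq_input t
      have h2 := ofReal_integral_eq_lintegral_ofReal hx
        (Filter.Eventually.of_forall fun x => sq_nonneg _)
      rw [hx1, ENNReal.ofReal_one] at h2
      rw [h2]
      refine lintegral_congr fun x => ?_
      rw [ENNReal.ofReal_pow (norm_nonneg _), ofReal_norm]
    simp [h1]
  unfold uplinkCapacity ergodicCapacity
  refine le_iSup_of_le (Measure.pi fun _ : Fin T => complexGaussian 1)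
    (le_iSup_of_le inferInstance (le_iSup_of_le hpow ?_))
  rw [hrate, ENNReal.ofReal_div_of_pos hlog]
  exact ENNReal.div_le_div_right hmain _

end Capacity

end

end CellFree

end

theorem theorem1 {M K τ T : ℕ} (hM : 0 < M) (hT : 0 < T)
    (p : CellFree.Params M K τ)
    (hβ : ∀ m k, 0 < p.β m k) (hγ : ∀ k, 0 ≤ p.γ k ∧ p.γ k ≤ 1)
    (hφ : ∀ k, ‖p.φ k‖ = 1)
    (hκt : 0 < p.κt ∧ p.κt ≤ 1) (hκr : 0 < p.κr ∧ p.κr ≤ 1)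
    (hρp : 0 < p.ρp) (hρu : 0 < p.ρu) (hσ : 0 < p.σ2)
    {Ω : Type*} [MeasurableSpace Ω] (μ : MeasureTheory.Measure Ω)
    [MeasureTheory.IsProbabilityMeasure μ]
    (g : Fin M → Fin K → Ω → ℂ) (Z : CellFree.Source M K τ T → Ω → ℂ)
    (hmodel : CellFree.IsUplinkModel p μ g Z) (k : Fin K) :
    (∀ m, CellFree.lmmseCoeff μ (CellFree.despread p g Z m k) (g m k) = (p.c m k : ℂ)) ∧
    (∀ m, ∫ ω, ‖CellFree.channelEstimate p μ g Z m k ω‖ ^ 2 ∂μ = p.lam m k) ∧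
    ((p.rate k : ℝ) : EReal) ≤ ((CellFree.uplinkCapacity p μ g Z k : ENNReal) : EReal) := by
  have hp : p.Admissible := ⟨hβ, hγ, hφ, hκt, hκr, hρp, hρu, hσ⟩
  refine ⟨fun m => hmodel.lmmseCoeff_eq hp m k,
    fun m => hmodel.integral_norm_sq_channelEstimate hp m k, ?_⟩
  -- `ENNReal.ofReal` truncates at 0 and hence can only increase the rate.
  calc ((p.rate k : ℝ) : EReal) ≤ ((ENNReal.ofReal (p.rate k) : ENNReal) : EReal) := by
        rw [EReal.coe_ennreal_ofReal]
        exact_mod_cast le_max_left _ _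
    _ ≤ _ := by
        exact_mod_cast hmodel.rate_le_uplinkCapacity hM hT hp k
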